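/- Let $\mathcal A$ be an alphabet with $d\ge 2$ letters and let $\pi_t,\pi_b:\mathcal A\to\{1,\dots,d\}$ be bijections which are irreducible: $\pi_t^{-1}(\{1,\dots,k\})\neq\pi_b^{-1}(\{1,\dots,k\})$ for $1\le k<d$. Let $T$ be a standard interval exchange map with combinatorial data $\pi=(\pi_t,\pi_b)$ on a bounded open interval $I=(u_0,u_d)$: given lengths $\lambda_\alpha>0$ with $\sum_\alpha\lambda_\alpha=u_d-u_0$, put $$u^t_k=u_0+\sum_{\pi_t(\alpha)\le k}\lambda_\alpha,\qquad u^b_k=u_0+\sum_{\pi_b(\alpha)\le k}\lambda_\alpha ,\qquad I^t_\alpha=(u^t_{\pi_t(\alpha)-1},u^t_{\pi_t(\alpha)}),\qquad I^b_\alpha=(u^b_{\pi_b(\alpha)-1},u^b_{\pi_b(\alpha)});$$ $T$ is defined on $\sqcup_\alpha I^t_\alpha$ and is, on each $I^t_\alpha$, the translation onto $I^b_\alpha$. Assume that $T$ has no connection, i.e. there are no $m\ge 0$ and $0<i,j<d$ with $T^m(u^b_j)=u^t_i$. Let $g$ be the genus of the closed oriented surface obtained by suspending $T$. This surface comes from a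 $2d$-gon bounded by a top and a bottom path with common first and last vertices, whose sides are labelled in the order $\pi_t$, resp. $\pi_b$, by gluing the top and bottom sides with the same label by a translation; thus $2-2g=s-d+1$, where $s$ is the number of classes of vertices of the polygon after gluing. Let $\sigma$ be the permutation of $\mathcal A\times\{L,R\}$ given by - $\sigma(\alpha,R)=(\beta,L)$ with $\pi_t(\beta)=\pi_t(\alpha)+1$ if $\pi_t(\alpha)<d$, and $\sigma(\alpha,R)=(\pi_b^{-1}(d),R)$ if $\pi_t(\alpha)=d$; - $\sigma(\alpha,L)=(\beta,R)$ with $\pi_b(\beta)=\pi_b(\alpha)-1$ if $\pi_b(\alpha)>1$, and $\sigma(\alpha,L)=(\pi_t^{-1}(1),L)$ if $\pi_b(\alpha)=1$. For a function $\varphi$ on $\sqcup I^t_\alpha$ whose restriction to each $I^t_\alpha$ extends continuously to the closure, let $\varphi(\alpha,L)$ and $\varphi(\alpha,R)$ be its limits at the left and right endpoints of $I^t_\alpha$, and for each cycle $C$ of $\sigma$ put $$(\partial\varphi)_C=\sum_{\upsilon\in C}\varepsilon(\upsilon)\,\varphi(\upsilon),\qquad \varepsilon(\alpha,L)=-1,\quad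 \varepsilon(\alpha,R)=+1 .$$ Let $D$ denote the derivative. Let $\Gamma_T$ be the space of functions $\chi$ on $\sqcup I^t_\alpha$, constant on each $I^t_\alpha$, which can be written $\chi=\psi\circ T-\psi$ for some $\psi\in C^0(\overline I)$. For an integer $r\ge 1$ let - $\Gamma(r)$ be the space of functions $\chi$ on $\sqcup I^t_\alpha$ whose restriction to each $I^t_\alpha$ is a polynomial of degree $<r$; - $\Gamma_\partial(r)$ be the subspace of those $\chi\in\Gamma(r)$ with $\partial D^i\chi=0$ for all $0\le i<r$; - $\Gamma_T(r)$ be the subspace of those $\chi\in\Gamma(r)$ which can be written $\chi=\psi\circ T-\psi$ for some $\psi\in C^{r-1}(\overline I)$. Then, for every $r\ge 1$, $$\dim\Gamma(r)=rd,\qquad \dim\Gamma_\partial(r)=(2g-1)r+1,\qquad \dim\Gamma_T(r)=\dim\Gamma_T+r-1 .$$ -/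

import Mathlib

open Filter Topology Polynomial
open scoped ContDiff

noncomputable section

/-- Combinatorial data on a finite alphabet `A` with `d` letters: the positions of the letters in
the top and in the bottom partition. Positions are numbered `0, …, d - 1` (rather than
`1, …, d`). -/
structure CombData (A : Type*) [Fintype A] where
  top : A ≃ Fin (Fintype.card A)
  bot : A ≃ Fin (Fintype.card A)

namespace CombData

variable {A : Type*} [Fintype A] (π : CombData A)

/-- For `1 ≤ k < d`, the first `k` letters of the top and of the bottom row form different
sets. -/
def Irreducible : Prop :=
  ∀ k : ℕ, 1 ≤ k → k < Fintype.card A →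
    {α : A | (π.top α : ℕ) < k} ≠ {α : A | (π.bot α : ℕ) < k}

/-! ### The glued polygon and its genus

The polygon has a top boundary path through `d + 1` vertices and a bottom boundary path through
`d + 1` vertices, with common first and common last vertex. The side of the top path labelled `α`
joins the vertices number `π.top α` and `π.top α + 1`, the side of the bottom path labelled `α`
joins those number `π.bot α` and `π.bot α + 1`, and these two sides are glued by a translation. -/

/-- The identifications between polygon vertices: `Sum.inl k` is the vertex number `k` of the top
path and `Sum.inr k` is the vertex number `k` of the bottom path. -/
inductive VertexGlue :
    Fin (Fintype.card A + 1) ⊕ Fin (Fintype.card A + 1) →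
    Fin (Fintype.card A + 1) ⊕ Fin (Fintype.card A + 1) → Prop
  | first : VertexGlue (Sum.inl 0) (Sum.inr 0)
  | last : VertexGlue (Sum.inl (Fin.last _)) (Sum.inr (Fin.last _))
  | left (α : A) : VertexGlue (Sum.inl (π.top α).castSucc) (Sum.inr (π.bot α).castSucc)
  | right (α : A) : VertexGlue (Sum.inl (π.top α).succ) (Sum.inr (π.bot α).succ)

/-- The marked points of the suspended surface: the vertices of the polygon after gluing
(`Quot` takes the quotient by the equivalence relation generated by `VertexGlue`). -/
def MarkedPoint : Type := Quot π.VertexGlue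

/-- The Euler characteristic `V - E + F` of the surface obtained by gluing the sides of the
polygon: the vertices are the marked points, there is one edge for each letter, and one face. -/
def eulerChar : ℤ := (Nat.card π.MarkedPoint : ℤ) - (Fintype.card A : ℤ) + 1

/-- The genus of the (closed, connected, oriented) suspended surface, from `χ = 2 - 2g`. -/
def genus : ℤ := (2 - π.eulerChar) / 2

/-! ### The permutation `σ` -/

/-- The permutation `σ` of the letters-with-a-side as a bare function. The pair `(α, false)` is
the left endpoint `(α, L)` and `(α, true)` is the right endpoint `(α, R)`. -/
def sigmaFun : A × Bool → A × Bool
  | (α, true) =>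
      if h : (π.top α : ℕ) + 1 < Fintype.card A then
        (π.top.symm ⟨(π.top α : ℕ) + 1, h⟩, false)
      else
        (π.bot.symm ⟨Fintype.card A - 1, Nat.sub_lt (Fin.pos (π.top α)) Nat.one_pos⟩, true)
  | (α, false) =>
      if (π.bot α : ℕ) = 0 then
        (π.top.symm ⟨0, Fin.pos (π.top α)⟩, false)
      else
        (π.bot.symm ⟨(π.bot α : ℕ) - 1, lt_of_le_of_lt (Nat.sub_le _ _) (π.bot α).isLt⟩, true)

lemma sigmaFun_injective : Function.Injective π.sigmaFun := by
  rintro ⟨α, a⟩ ⟨β, b⟩ h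
  have htα := (π.top α).isLt
  have htβ := (π.top β).isLt
  have hbα := (π.bot α).isLt
  have hbβ := (π.bot β).isLt
  cases a <;> cases b <;> simp only [sigmaFun] at h <;> split_ifs at h <;>
    simp only [Prod.mk.injEq, EmbeddingLike.apply_eq_iff_eq, Fin.mk.injEq, reduceCtorEq,
      and_true, and_false] at h
  all_goals first
    | (exfalso; omega)
    | (have : π.top α = π.top β := Fin.ext (by omega)
       simpa using this)
    | (have : π.bot α = π.bot β := Fin.ext (by omega)
       simpa using this)

/-- The permutation `σ`. -/
def sigma : Equiv.Perm (A × Bool) :=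
  Equiv.ofBijective π.sigmaFun (Finite.injective_iff_bijective.1 π.sigmaFun_injective)

/-- The set of cycles of `σ` (a fixed point counts as a cycle). -/
def Cycle : Type _ := Quotient (Equiv.Perm.SameCycle.setoid π.sigma)

/-- The cycle of `σ` through `υ`. -/
def cycleOf (υ : A × Bool) : π.Cycle :=
  Quotient.mk (Equiv.Perm.SameCycle.setoid π.sigma) υ

end CombData

/-- A standard interval exchange map with irreducible combinatorial data: it is determined by the
combinatorial data, by the left endpoint `u₀` of the interval and by the lengths of the exchanged
intervals. -/
structure StandardIEM (A : Type*) [Fintype A] where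
  two_le_card : 2 ≤ Fintype.card A
  data : CombData A
  irreducible : data.Irreducible
  u₀ : ℝ
  len : A → ℝ
  len_pos : ∀ α, 0 < len α

namespace StandardIEM

variable {A : Type*} [Fintype A] (T : StandardIEM A)

/-- The points `u₀ = uᵗ₀ < uᵗ₁ < ⋯ < uᵗ_d` bounding the intervals of the top partition. -/
def topPt (k : ℕ) : ℝ := T.u₀ + ∑ α with (T.data.top α : ℕ) < k, T.len α

/-- The points `u₀ = uᵇ₀ < uᵇ₁ < ⋯ < uᵇ_d` bounding the intervals of the bottom partition. -/
def botPt (k : ℕ) : ℝ := T.u₀ + ∑ α with (T.data.bot α : ℕ) < k, T.len α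

/-- The right endpoint `u_d` of the interval `I = (u₀, u_d)`. -/
def uEnd : ℝ := T.u₀ + ∑ α, T.len α

/-- The left endpoint of the top interval labelled `α`. -/
def topLeft (α : A) : ℝ := T.topPt (T.data.top α)

/-- The right endpoint of the top interval labelled `α`. -/
def topRight (α : A) : ℝ := T.topPt ((T.data.top α : ℕ) + 1)

/-- The open top interval labelled `α`. -/
def topInterval (α : A) : Set ℝ := Set.Ioo (T.topLeft α) (T.topRight α)

/-- The domain of the map: the union of the open top intervals. -/
def domain : Set ℝ := ⋃ α, T.topInterval α

/-- The letter of the top interval that contains a point of the domain. -/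
def letter (x : T.domain) : A := (Set.mem_iUnion.1 x.2).choose

lemma mem_letter (x : T.domain) : (x : ℝ) ∈ T.topInterval (T.letter x) :=
  (Set.mem_iUnion.1 x.2).choose_spec

lemma mem_domain {α : A} {x : ℝ} (hx : x ∈ T.topInterval α) : x ∈ T.domain :=
  Set.mem_iUnion.2 ⟨α, hx⟩

/-- The translation that carries the top interval labelled `α` onto the bottom one. -/
def shift (α : A) : ℝ := T.botPt (T.data.bot α) - T.topPt (T.data.top α)

/-- The interval exchange map itself; it is only defined on the union of the top intervals. -/
def map (x : T.domain) : ℝ := x + T.shift (T.letter x)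

/-- `y` is the image of `x` under the partially defined map. -/
def Step (x y : ℝ) : Prop := ∃ h : x ∈ T.domain, T.map ⟨x, h⟩ = y

/-- There is a connection: `T^m (uᵇ_j) = uᵗ_i` for some `m ≥ 0` and some singularities
(`0 < i, j < d`), all the iterates involved being defined. -/
def HasConnection : Prop :=
  ∃ i j : ℕ, 0 < i ∧ i < Fintype.card A ∧ 0 < j ∧ j < Fintype.card A ∧
    Relation.ReflTransGen T.Step (T.botPt j) (T.topPt i)

/-- Functions on the union of the top intervals. -/
abbrev Fn : Type := T.domain → ℝ

/-! ### Piecewise smooth functions -/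

/-- The functions whose restriction to each top interval extends to a `C^n` function on the
closure of that interval. -/
def CSpace (n : WithTop ℕ∞) : Submodule ℝ T.Fn where
  carrier := {φ | ∀ α, ∃ f : ℝ → ℝ, ContDiffOn ℝ n f (Set.Icc (T.topLeft α) (T.topRight α)) ∧
    ∀ x : T.domain, (x : ℝ) ∈ T.topInterval α → φ x = f x}
  add_mem' := by
    intro φ ψ hφ hψ α
    obtain ⟨f, hf, hf'⟩ := hφ α
    obtain ⟨g, hg, hg'⟩ := hψ α
    exact ⟨f + g, hf.add hg, fun x hx => by simp [hf' x hx, hg' x hx]⟩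
  zero_mem' := fun α => ⟨0, contDiffOn_const, fun x hx => rfl⟩
  smul_mem' := by
    intro c φ hφ α
    obtain ⟨f, hf, hf'⟩ := hφ α
    exact ⟨c • f, contDiffOn_const.smul hf, fun x hx => by simp [hf' x hx]⟩

/-- The derivative of a function on the union of the top intervals (an open subset of the line;
how the function is extended to the whole line is irrelevant there). -/
def D (φ : T.Fn) : T.Fn :=
  fun x => deriv (Function.extend (Subtype.val : T.domain → ℝ) φ 0) x

/-- The space `Γ` of functions that are constant on each top interval. -/
def Gam : Submodule ℝ T.Fn where
  carrier := {χ | ∀ α, ∃ c : ℝ, ∀ x : T.domain, (x : ℝ) ∈ T.topInterval α → χ x = c}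
  add_mem' := by
    intro φ ψ hφ hψ α
    obtain ⟨a, ha⟩ := hφ α
    obtain ⟨b, hb⟩ := hψ α
    exact ⟨a + b, fun x hx => by simp [ha x hx, hb x hx]⟩
  zero_mem' := fun α => ⟨0, fun x hx => rfl⟩
  smul_mem' := by
    intro c φ hφ α
    obtain ⟨a, ha⟩ := hφ α
    exact ⟨c * a, fun x hx => by simp [ha x hx]⟩

/-- The space `Γ(r)`: the `C^∞` functions whose restriction to each top interval is a polynomial
of degree `< r`. -/
def GamPoly (r : ℕ) : Submodule ℝ T.Fn where
  carrier := {χ | χ ∈ T.CSpace ∞ ∧ ∀ α, ∃ p : ℝ[X], p.degree < (r : WithBot ℕ) ∧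
    ∀ x : T.domain, (x : ℝ) ∈ T.topInterval α → χ x = p.eval (x : ℝ)}
  add_mem' := by
    rintro φ ψ ⟨h1, hφ⟩ ⟨h2, hψ⟩
    refine ⟨add_mem h1 h2, fun α => ?_⟩
    obtain ⟨p, hp, hp'⟩ := hφ α
    obtain ⟨q, hq, hq'⟩ := hψ α
    exact ⟨p + q, lt_of_le_of_lt (degree_add_le p q) (max_lt hp hq),
      fun x hx => by simp [hp' x hx, hq' x hx]⟩
  zero_mem' := ⟨zero_mem _, fun α => ⟨0, by simp, fun x hx => by simp⟩⟩
  smul_mem' := by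
    rintro c φ ⟨h1, hφ⟩
    refine ⟨Submodule.smul_mem _ c h1, fun α => ?_⟩
    obtain ⟨p, hp, hp'⟩ := hφ α
    exact ⟨c • p, lt_of_le_of_lt (degree_smul_le c p) hp, fun x hx => by simp [hp' x hx]⟩

/-! ### The boundary operator -/

/-- The endpoint of the top interval labelled `υ.1` on the side `υ.2`. -/
def endpoint (υ : A × Bool) : ℝ := if υ.2 then T.topRight υ.1 else T.topLeft υ.1

/-- Points of the domain that tend to the endpoint `υ` from within the top interval labelled
`υ.1`. -/
def endFilter (υ : A × Bool) : Filter T.domain :=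
  comap Subtype.val (𝓝[T.topInterval υ.1] (T.endpoint υ))

/-- The value `φ(υ)`: the limit of `φ` at the endpoint `υ`. -/
def endVal (φ : T.Fn) (υ : A × Bool) : ℝ := limUnder (T.endFilter υ) φ

/-- The sign `ε(υ)`, equal to `-1` at left and `+1` at right endpoints. -/
def sgn (υ : A × Bool) : ℝ := if υ.2 then 1 else -1

open scoped Classical in
/-- The boundary operator: the component of `∂φ` on a cycle `C` of `σ` is
`∑_{υ ∈ C} ε(υ) φ(υ)`. It is meant for functions in `C^0`, whose endpoint limits all exist. -/
def bdry (φ : T.Fn) : T.data.Cycle → ℝ :=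
  fun C => ∑ υ with T.data.cycleOf υ = C, sgn υ * T.endVal φ υ

/-! ### Facts needed to see that the next definition gives a linear subspace -/

lemma topLeft_lt_topRight (α : A) : T.topLeft α < T.topRight α := by
  unfold topLeft topRight topPt
  have : ∑ β with (T.data.top β : ℕ) < (T.data.top α : ℕ), T.len β <
      ∑ β with (T.data.top β : ℕ) < (T.data.top α : ℕ) + 1, T.len β := by
    apply Finset.sum_lt_sum_of_subset (i := α)
    · intro β hβ
      simp only [Finset.mem_filter, Finset.mem_univ, true_and] at hβ ⊢
      omega
    · simp
    · simp
    · exact T.len_pos α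
    · exact fun β _ _ => (T.len_pos β).le
  linarith

lemma endpoint_mem_Icc (υ : A × Bool) :
    T.endpoint υ ∈ Set.Icc (T.topLeft υ.1) (T.topRight υ.1) := by
  have h := (T.topLeft_lt_topRight υ.1).le
  unfold endpoint
  split_ifs
  · exact ⟨h, le_rfl⟩
  · exact ⟨le_rfl, h⟩

instance endFilter_neBot (υ : A × Bool) : (T.endFilter υ).NeBot := by
  have h := T.topLeft_lt_topRight υ.1
  have : (𝓝[T.topInterval υ.1] (T.endpoint υ)).NeBot := by
    rw [← mem_closure_iff_nhdsWithin_neBot, topInterval, closure_Ioo h.ne]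
    exact T.endpoint_mem_Icc υ
  refine comap_neBot_iff.2 fun t ht => ?_
  obtain ⟨x, hx1, hx2⟩ := this.nonempty_of_mem (inter_mem ht self_mem_nhdsWithin)
  exact ⟨⟨x, T.mem_domain hx2⟩, hx1⟩

lemma tendsto_endVal {φ : T.Fn} (hφ : φ ∈ T.CSpace 0) (υ : A × Bool) :
    Tendsto φ (T.endFilter υ) (𝓝 (T.endVal φ υ)) := by
  obtain ⟨f, hf, hf'⟩ := hφ υ.1
  refine tendsto_nhds_limUnder ⟨f (T.endpoint υ), ?_⟩
  have h1 : Tendsto f (𝓝[T.topInterval υ.1] (T.endpoint υ)) (𝓝 (f (T.endpoint υ))) :=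
    ((hf.continuousOn _ (T.endpoint_mem_Icc υ)).mono Set.Ioo_subset_Icc_self)
  have h2 : Tendsto (fun x : T.domain => f x) (T.endFilter υ) (𝓝 (f (T.endpoint υ))) :=
    h1.comp tendsto_comap
  refine h2.congr' ?_
  have h3 : ∀ᶠ x : T.domain in T.endFilter υ, (x : ℝ) ∈ T.topInterval υ.1 :=
    tendsto_comap.eventually self_mem_nhdsWithin
  filter_upwards [h3] with x hx
  exact (hf' x hx).symm

lemma endVal_add {φ ψ : T.Fn} (hφ : φ ∈ T.CSpace 0) (hψ : ψ ∈ T.CSpace 0) (υ : A × Bool) :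
    T.endVal (φ + ψ) υ = T.endVal φ υ + T.endVal ψ υ :=
  ((T.tendsto_endVal hφ υ).add (T.tendsto_endVal hψ υ)).limUnder_eq

lemma endVal_smul (c : ℝ) {φ : T.Fn} (hφ : φ ∈ T.CSpace 0) (υ : A × Bool) :
    T.endVal (c • φ) υ = c * T.endVal φ υ :=
  ((T.tendsto_endVal hφ υ).const_mul c).limUnder_eq

lemma bdry_add {φ ψ : T.Fn} (hφ : φ ∈ T.CSpace 0) (hψ : ψ ∈ T.CSpace 0) :
    T.bdry (φ + ψ) = T.bdry φ + T.bdry ψ := by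
  funext C
  simp [bdry, T.endVal_add hφ hψ, mul_add, Finset.sum_add_distrib]

lemma bdry_smul (c : ℝ) {φ : T.Fn} (hφ : φ ∈ T.CSpace 0) :
    T.bdry (c • φ) = c • T.bdry φ := by
  funext C
  simp [bdry, T.endVal_smul c hφ, Finset.mul_sum, mul_left_comm]

lemma GamPoly_le_CSpace (r : ℕ) : T.GamPoly r ≤ T.CSpace 0 := by
  intro χ hχ α
  obtain ⟨f, hf, hf'⟩ := hχ.1 α
  exact ⟨f, hf.of_le (by simp), hf'⟩

lemma extend_eventuallyEq {φ : T.Fn} {f : ℝ → ℝ} {α : A}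
    (h : ∀ x : T.domain, (x : ℝ) ∈ T.topInterval α → φ x = f x) {x : ℝ}
    (hx : x ∈ T.topInterval α) :
    Function.extend (Subtype.val : T.domain → ℝ) φ 0 =ᶠ[𝓝 x] f := by
  filter_upwards [isOpen_Ioo.mem_nhds hx] with y hy
  have := Subtype.val_injective.extend_apply φ 0 (⟨y, T.mem_domain hy⟩ : T.domain)
  exact this.trans (h ⟨y, T.mem_domain hy⟩ hy)

lemma D_eq_of_eq {φ : T.Fn} {f : ℝ → ℝ} {α : A}
    (h : ∀ x : T.domain, (x : ℝ) ∈ T.topInterval α → φ x = f x) (x : T.domain)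
    (hx : (x : ℝ) ∈ T.topInterval α) : T.D φ x = deriv f x :=
  (T.extend_eventuallyEq h hx).deriv_eq

lemma D_eq_eval {φ : T.Fn} {p : ℝ[X]} {α : A}
    (h : ∀ x : T.domain, (x : ℝ) ∈ T.topInterval α → φ x = p.eval (x : ℝ)) (x : T.domain)
    (hx : (x : ℝ) ∈ T.topInterval α) : T.D φ x = (derivative p).eval (x : ℝ) := by
  rw [T.D_eq_of_eq (f := fun z => p.eval z) h x hx, Polynomial.deriv]

lemma D_mem_GamPoly {r : ℕ} {χ : T.Fn} (hχ : χ ∈ T.GamPoly r) : T.D χ ∈ T.GamPoly r := by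
  have key : ∀ α, ∃ p : ℝ[X], p.degree < (r : WithBot ℕ) ∧
      ∀ x : T.domain, (x : ℝ) ∈ T.topInterval α → T.D χ x = p.eval (x : ℝ) := by
    intro α
    obtain ⟨p, hp, hp'⟩ := hχ.2 α
    refine ⟨derivative p, lt_of_le_of_lt degree_derivative_le hp, T.D_eq_eval hp'⟩
  refine ⟨fun α => ?_, key⟩
  obtain ⟨p, -, hp'⟩ := key α
  exact ⟨fun x => p.eval x, (by simpa using (p.contDiff_aeval (𝕜 := ℝ) ∞).contDiffOn), hp'⟩

lemma D_add {r : ℕ} {φ ψ : T.Fn} (hφ : φ ∈ T.GamPoly r) (hψ : ψ ∈ T.GamPoly r) :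
    T.D (φ + ψ) = T.D φ + T.D ψ := by
  funext x
  obtain ⟨p, -, hp⟩ := hφ.2 (T.letter x)
  obtain ⟨q, -, hq⟩ := hψ.2 (T.letter x)
  have hx := T.mem_letter x
  have h : ∀ y : T.domain, (y : ℝ) ∈ T.topInterval (T.letter x) →
      (φ + ψ) y = (p + q).eval (y : ℝ) := fun y hy => by simp [hp y hy, hq y hy]
  rw [Pi.add_apply, T.D_eq_eval h x hx, T.D_eq_eval hp x hx, T.D_eq_eval hq x hx]
  simp only [derivative_add, eval_add]

lemma D_smul {r : ℕ} (c : ℝ) {φ : T.Fn} (hφ : φ ∈ T.GamPoly r) :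
    T.D (c • φ) = c • T.D φ := by
  funext x
  obtain ⟨p, -, hp⟩ := hφ.2 (T.letter x)
  have hx := T.mem_letter x
  have h : ∀ y : T.domain, (y : ℝ) ∈ T.topInterval (T.letter x) →
      (c • φ) y = (c • p).eval (y : ℝ) := fun y hy => by simp [hp y hy]
  rw [Pi.smul_apply, T.D_eq_eval h x hx, T.D_eq_eval hp x hx]
  simp only [derivative_smul, eval_smul]

lemma iterate_D_mem {r : ℕ} {χ : T.Fn} (hχ : χ ∈ T.GamPoly r) (i : ℕ) :
    T.D^[i] χ ∈ T.GamPoly r := by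
  induction i with
  | zero => exact hχ
  | succ i ih => rw [Function.iterate_succ_apply']; exact T.D_mem_GamPoly ih

lemma iterate_D_add {r : ℕ} {φ ψ : T.Fn} (hφ : φ ∈ T.GamPoly r) (hψ : ψ ∈ T.GamPoly r) (i : ℕ) :
    T.D^[i] (φ + ψ) = T.D^[i] φ + T.D^[i] ψ := by
  induction i with
  | zero => rfl
  | succ i ih =>
    simp only [Function.iterate_succ_apply', ih]
    exact T.D_add (T.iterate_D_mem hφ i) (T.iterate_D_mem hψ i)

lemma iterate_D_smul {r : ℕ} (c : ℝ) {φ : T.Fn} (hφ : φ ∈ T.GamPoly r) (i : ℕ) :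
    T.D^[i] (c • φ) = c • T.D^[i] φ := by
  induction i with
  | zero => rfl
  | succ i ih =>
    simp only [Function.iterate_succ_apply', ih]
    exact T.D_smul c (T.iterate_D_mem hφ i)

/-- The space `Γ_∂(r)` of those `χ ∈ Γ(r)` with `∂ D^i χ = 0` for all `0 ≤ i < r`. -/
def GamBdry (r : ℕ) : Submodule ℝ T.Fn where
  carrier := {χ | χ ∈ T.GamPoly r ∧ ∀ i < r, T.bdry (T.D^[i] χ) = 0}
  add_mem' := by
    rintro φ ψ ⟨hφ, hφ'⟩ ⟨hψ, hψ'⟩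
    refine ⟨add_mem hφ hψ, fun i hi => ?_⟩
    rw [T.iterate_D_add hφ hψ, T.bdry_add (T.GamPoly_le_CSpace r (T.iterate_D_mem hφ i))
      (T.GamPoly_le_CSpace r (T.iterate_D_mem hψ i)), hφ' i hi, hψ' i hi, add_zero]
  zero_mem' := by
    refine ⟨zero_mem _, fun i hi => ?_⟩
    have h0 : (0 : T.Fn) ∈ T.GamPoly r := zero_mem _
    have h := T.iterate_D_smul 0 h0 i
    rw [smul_zero, zero_smul] at h
    have h' := T.bdry_smul 0 (zero_mem (T.CSpace 0))
    rw [smul_zero, zero_smul] at h'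
    rw [h, h']
  smul_mem' := by
    rintro c φ ⟨hφ, hφ'⟩
    refine ⟨Submodule.smul_mem _ c hφ, fun i hi => ?_⟩
    rw [T.iterate_D_smul c hφ, T.bdry_smul c (T.GamPoly_le_CSpace r (T.iterate_D_mem hφ i)),
      hφ' i hi, smul_zero]

/-! ### Coboundaries -/

/-- The functions of the form `ψ ∘ T - ψ` with `ψ` of class `C^n` on the closed interval
`[u₀, u_d]`. -/
def Coboundary (n : ℕ) : Submodule ℝ T.Fn where
  carrier := {χ | ∃ ψ : ℝ → ℝ, ContDiffOn ℝ n ψ (Set.Icc T.u₀ T.uEnd) ∧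
    ∀ x : T.domain, χ x = ψ (T.map x) - ψ x}
  add_mem' := by
    rintro φ φ' ⟨f, hf, hf'⟩ ⟨g, hg, hg'⟩
    exact ⟨f + g, hf.add hg, fun x => by simp only [Pi.add_apply, hf' x, hg' x]; ring⟩
  zero_mem' := ⟨0, contDiffOn_const, fun x => by simp⟩
  smul_mem' := by
    rintro c φ ⟨f, hf, hf'⟩
    exact ⟨c • f, contDiffOn_const.smul hf, fun x => by
      simp only [Pi.smul_apply, hf' x, smul_eq_mul]; ring⟩

/-- The space `Γ_T` of those `χ ∈ Γ` of the form `ψ ∘ T - ψ` with `ψ ∈ C^0([u₀, u_d])`. -/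
def GamT : Submodule ℝ T.Fn := T.Gam ⊓ T.Coboundary 0

/-- The space `Γ_T(r)`, for `r ≥ 1`, of those `χ ∈ Γ(r)` of the form `ψ ∘ T - ψ` with
`ψ ∈ C^{r-1}([u₀, u_d])`. -/
def GamTPoly (r : ℕ) : Submodule ℝ T.Fn := T.GamPoly r ⊓ T.Coboundary (r - 1)

end StandardIEM

end

/-! The first dimension is read off from the polynomial coefficients, one polynomial for each
letter.

For `GamBdry`, let s be the number of cycles of σ. The map `bdryPoly` into ℝ^(rs) has as kernel the
coordinates of Γ_∂(r), so its rank is needed. A vector x annihilating the range is tested on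
monomials X^i supported on a single interval. By `const_of_increment`, a function on the cycles
whose increments along the letters are c times the lengths is constant, and c = 0. Hence each level
x(i, ·) is constant, and testing on X^(i+1) shows that this constant is 0 unless i = r - 1. The
annihilator is therefore a line, the rank is rs - 1, and the kernel has dimension rd - rs + 1.
Cycles of σ are the marked points (`cycleEquivMarkedPoint`), so d - s = 2g - 1; a sign computation
(`even_card_cycle_add`) makes g an integer.

For `GamTPoly`, differentiation maps Γ_T(n+2) onto Γ_T(n+1), because a primitive of the transfer
function solves the lifted equation. If χ = ψ∘T - ψ is in the kernel, then ψ' is continuous and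
T-invariant, hence constant (`eq_of_continuousOn_of_invariant`, a Keane-type argument), so χ is a
multiple of the translation function `shiftFn`. Each differentiation thus loses exactly one
dimension. -/

noncomputable section

/-! ### Sign of a permutation and number of its cycles. -/

open Equiv in
/-- The cycles of a permutation, fixed points included, are its nontrivial cycles together with
its fixed points. -/
lemma card_quotient_sameCycle {α : Type*} [Fintype α] [DecidableEq α] (f : Perm α) :
    Nat.card (Quotient (Perm.SameCycle.setoid f)) + f.support.card =
      Fintype.card α + Multiset.card f.cycleType := by
  classical
  let F : α → f.cycleFactorsFinset ⊕ Function.fixedPoints f := fun x =>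
    if h : f x = x then Sum.inr ⟨x, h⟩
    else Sum.inl ⟨f.cycleOf x, Perm.cycleOf_mem_cycleFactorsFinset_iff.2 (Perm.mem_support.2 h)⟩
  have hF : ∀ x y, f.SameCycle x y ↔ F x = F y := by
    intro x y
    by_cases hx : f x = x <;> by_cases hy : f y = y
    · simp only [F, hx, hy, dif_pos, Sum.inr.injEq]
      refine ⟨fun h => Subtype.ext (h.eq_of_left hx), fun h => ?_⟩
      rw [Subtype.mk.inj h]
    · simp only [F, hx, hy, dif_pos, dif_neg, not_false_iff, reduceCtorEq, iff_false]
      intro h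
      exact hy (h.apply_eq_self_iff.1 hx)
    · simp only [F, hx, hy, dif_pos, dif_neg, not_false_iff, reduceCtorEq, iff_false]
      intro h
      exact hx (h.apply_eq_self_iff.2 hy)
    · simp only [F, hx, hy, dif_neg, not_false_iff, Sum.inl.injEq, Subtype.mk.injEq]
      exact Perm.sameCycle_iff_cycleOf_eq_of_mem_support (Perm.mem_support.2 hx)
        (Perm.mem_support.2 hy)
  have hbij : Function.Bijective (Quotient.lift (s := Perm.SameCycle.setoid f) F
      fun x y h => (hF x y).1 h) := by
    constructor
    · rintro ⟨x⟩ ⟨y⟩ h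
      exact Quotient.sound ((hF x y).2 h)
    · rintro (⟨c, hc⟩ | ⟨x, hx⟩)
      · obtain ⟨x, hx⟩ := (Perm.mem_cycleFactorsFinset_iff.1 hc).1.nonempty_support
        refine ⟨Quotient.mk _ x, ?_⟩
        have hfx : f x ≠ x := Perm.mem_support.1
          (Perm.mem_cycleFactorsFinset_support_le hc hx)
        simp only [Quotient.lift_mk, F, hfx, dif_neg, not_false_iff, Sum.inl.injEq,
          Subtype.mk.injEq]
        exact (Perm.cycle_is_cycleOf hx hc).symm
      · refine ⟨Quotient.mk _ x, ?_⟩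
        have hx' : f x = x := hx
        simp [F, hx']
  rw [Nat.card_congr (Equiv.ofBijective _ hbij), Nat.card_sum, Nat.card_eq_fintype_card,
    Nat.card_eq_fintype_card, Perm.card_fixedPoints, Perm.sum_cycleType]
  have h1 : f.support.card ≤ Fintype.card α := Finset.card_le_univ _
  have h2 : Multiset.card f.cycleType = Fintype.card f.cycleFactorsFinset := by
    rw [Perm.cycleType_def, Multiset.card_map, Fintype.card_coe]; rfl
  omega

open Equiv in
lemma sign_eq_neg_one_pow_card_cycles {α : Type*} [Fintype α] [DecidableEq α] (f : Perm α) :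
    Perm.sign f = (-1) ^ (Fintype.card α + Nat.card (Quotient (Perm.SameCycle.setoid f))) := by
  have h := card_quotient_sameCycle f
  rw [Perm.sign_of_cycleType, Perm.sum_cycleType]
  apply neg_one_pow_congr
  have h' := congrArg Even h
  simp only [Nat.even_add, eq_iff_iff] at h' ⊢
  tauto

lemma coe_finRotate_eq_ite (n : ℕ) (i : Fin n) :
    (finRotate n i : ℕ) = if (i : ℕ) + 1 < n then (i : ℕ) + 1 else 0 := by
  cases n with
  | zero => exact i.elim0
  | succ n =>
    split_ifs with h
    · exact coe_finRotate_of_ne_last (by intro h'; simp [h'] at h)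
    · have : i = Fin.last n := Fin.ext (by simp; omega)
      simp [this]

/-! ### Cycles of σ, marked points and the genus. -/

namespace CombData

variable {A : Type*} [Fintype A] (π : CombData A)

lemma sigma_apply (υ : A × Bool) : π.sigma υ = π.sigmaFun υ := rfl

lemma cycleOf_sigma (υ : A × Bool) : π.cycleOf (π.sigma υ) = π.cycleOf υ :=
  Quotient.sound (s := Equiv.Perm.SameCycle.setoid π.sigma)
    (Equiv.Perm.sameCycle_apply_left.2 (Equiv.Perm.SameCycle.refl _ _))

instance : Finite π.Cycle := Quotient.finite _

/-- A function on the ends that is invariant under `σ` is constant on the cycles. -/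
def liftCycle {X : Type*} (f : A × Bool → X) (hf : ∀ υ, f (π.sigma υ) = f υ) : π.Cycle → X :=
  Quotient.lift f (by
    rintro x y ⟨i, rfl⟩
    have hinv : ∀ υ, f (π.sigma⁻¹ υ) = f υ := fun υ => by
      rw [← hf (π.sigma⁻¹ υ)]; simp
    induction i using Int.induction_on with
    | zero => rfl
    | succ i ih => rw [add_comm, zpow_one_add, Equiv.Perm.mul_apply, hf]; exact ih
    | pred i ih =>
      rw [sub_eq_neg_add, zpow_add, zpow_neg_one, Equiv.Perm.mul_apply, hinv]; exact ih)

lemma sigma_true_of_lt {α : A} (h : (π.top α : ℕ) + 1 < Fintype.card A) :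
    π.sigma (α, true) = (π.top.symm ⟨(π.top α : ℕ) + 1, h⟩, false) := by
  rw [sigma_apply, sigmaFun, dif_pos h]

lemma sigma_true_of_not_lt {α : A} (h : ¬ (π.top α : ℕ) + 1 < Fintype.card A) :
    π.sigma (α, true) = (π.bot.symm
      ⟨Fintype.card A - 1, Nat.sub_lt (Fin.pos (π.top α)) Nat.one_pos⟩, true) := by
  rw [sigma_apply, sigmaFun, dif_neg h]

lemma sigma_false_of_eq {α : A} (h : (π.bot α : ℕ) = 0) :
    π.sigma (α, false) = (π.top.symm ⟨0, Fin.pos (π.top α)⟩, false) := by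
  rw [sigma_apply, sigmaFun, if_pos h]

lemma sigma_false_of_ne {α : A} (h : (π.bot α : ℕ) ≠ 0) :
    π.sigma (α, false) = (π.bot.symm
      ⟨(π.bot α : ℕ) - 1, lt_of_le_of_lt (Nat.sub_le _ _) (π.bot α).isLt⟩, true) := by
  rw [sigma_apply, sigmaFun, if_neg h]

/-- The ends of the letters, ordered along the boundary of the polygon: the left ends along the
top path, then the right ends backwards along the bottom path. -/
def endOrder : A × Bool ≃ Fin (Fintype.card A + Fintype.card A) :=
  ((Equiv.prodComm _ _).trans (Equiv.boolProdEquivSum A)).trans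
    ((Equiv.sumCongr π.top (π.bot.trans Fin.revPerm)).trans finSumFinEquiv)

lemma endOrder_false (α : A) : (π.endOrder (α, false) : ℕ) = π.top α := by
  simp [endOrder, Equiv.boolProdEquivSum]

lemma endOrder_true (α : A) :
    (π.endOrder (α, true) : ℕ) = Fintype.card A + (Fintype.card A - 1 - π.bot α) := by
  simp [endOrder, Equiv.boolProdEquivSum]
  omega

/-- The exchange of the two ends of each letter. -/
def flipEnds (A : Type*) : Equiv.Perm (A × Bool) :=
  Equiv.prodCongrRight fun _ => Equiv.swap false true

/-- Once around the polygon: σ after the exchange of ends is a single cycle through all 2d ends. Its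
sign is known, and this determines the sign of σ. -/
lemma endOrder_sigma_flip (υ : A × Bool) :
    π.endOrder (π.sigma (flipEnds A υ)) = finRotate _ (π.endOrder υ) := by
  apply Fin.ext
  rw [coe_finRotate_eq_ite]
  obtain ⟨α, a⟩ := υ
  have ht := (π.top α).isLt
  have hb := (π.bot α).isLt
  cases a
  · have : flipEnds A (α, false) = (α, true) := by simp [flipEnds]
    rw [this, endOrder_false]
    by_cases h : (π.top α : ℕ) + 1 < Fintype.card A
    · rw [sigma_true_of_lt _ h, endOrder_false, if_pos (by omega)]
      simp
    · rw [sigma_true_of_not_lt _ h, endOrder_true, if_pos (by omega)]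
      simp
      omega
  · have : flipEnds A (α, true) = (α, false) := by simp [flipEnds]
    rw [this, endOrder_true]
    by_cases h : (π.bot α : ℕ) = 0
    · rw [sigma_false_of_eq _ h, endOrder_false, if_neg (by omega)]
      simp
    · rw [sigma_false_of_ne _ h, endOrder_true, if_pos (by omega)]
      simp
      omega

/-- The number of cycles of `σ` has the parity of `d + 1`. -/
lemma even_card_cycle_add (hd : 0 < Fintype.card A) :
    Even (Nat.card π.Cycle + Fintype.card A + 1) := by
  classical
  have h1 : π.sigma * flipEnds A = π.endOrder.symm.permCongr (finRotate _) := by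
    ext1 υ
    apply π.endOrder.injective
    rw [Equiv.Perm.mul_apply, endOrder_sigma_flip]
    simp [Equiv.permCongr_apply]
  have h2 := congrArg Equiv.Perm.sign h1
  rw [Equiv.Perm.sign_mul, Equiv.Perm.sign_permCongr, sign_finRotate,
    sign_eq_neg_one_pow_card_cycles, flipEnds, Equiv.Perm.sign_prodCongrRight] at h2
  have h3 : Nat.card (Quotient (Equiv.Perm.SameCycle.setoid π.sigma)) = Nat.card π.Cycle := rfl
  rw [h3] at h2
  simp only [Fintype.card_prod, Fintype.card_bool] at h2
  rw [Equiv.Perm.sign_swap (by simp), Finset.prod_const, Finset.card_univ, ← pow_add] at h2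
  rw [Nat.even_add_one, Nat.not_even_iff_odd, ← neg_one_pow_eq_neg_one_iff_odd (R := ℤˣ) (by decide)]
  rw [Odd.neg_one_pow (⟨Fintype.card A - 1, by omega⟩ : Odd (Fintype.card A + Fintype.card A - 1))]
    at h2
  refine Eq.trans ?_ h2
  apply neg_one_pow_congr
  simp only [Nat.even_add, Nat.even_mul]
  simp

/-- The marked point at an end of (the top side labelled by) a letter. -/
def endPoint (υ : A × Bool) : π.MarkedPoint :=
  Quot.mk _ (Sum.inl (if υ.2 then (π.top υ.1).succ else (π.top υ.1).castSucc))

/-- Consecutive sides of a path share a vertex, and gluing lets an end be read on either path. The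
two exceptional cases of σ are the common first and last vertices. -/
lemma endPoint_sigma (υ : A × Bool) : π.endPoint (π.sigma υ) = π.endPoint υ := by
  obtain ⟨α, a⟩ := υ
  have ht := (π.top α).isLt
  have hb := (π.bot α).isLt
  have left (β) : π.endPoint (β, false) = Quot.mk _ (Sum.inr (π.bot β).castSucc) := by
    exact Quot.sound (VertexGlue.left β)
  have right (β) : π.endPoint (β, true) = Quot.mk _ (Sum.inr (π.bot β).succ) := by
    exact Quot.sound (VertexGlue.right β)
  cases a
  · by_cases h : (π.bot α : ℕ) = 0
    · rw [sigma_false_of_eq _ h, left α]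
      have h1 : (π.bot α).castSucc = 0 := Fin.ext (by simpa using h)
      have h2 : (⟨0, Fin.pos (π.top α)⟩ : Fin (Fintype.card A)).castSucc = 0 := rfl
      simp only [endPoint, h1, Equiv.apply_symm_apply, h2]
      exact Quot.sound VertexGlue.first
    · rw [sigma_false_of_ne _ h, left α, right, Equiv.apply_symm_apply]
      congr 2
      exact Fin.ext (by simp; omega)
  · by_cases h : (π.top α : ℕ) + 1 < Fintype.card A
    · rw [sigma_true_of_lt _ h]
      simp only [endPoint, Equiv.apply_symm_apply]
      congr 2
    · rw [sigma_true_of_not_lt _ h, right, Equiv.apply_symm_apply]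
      have h1 : (π.top α).succ = Fin.last _ := Fin.ext (by simp; omega)
      simp only [endPoint, if_true, h1]
      refine Eq.trans ?_ (Quot.sound VertexGlue.last).symm
      congr 2
      exact Fin.ext (by simp; omega)

/-- The cycle of `σ` at a vertex of the polygon. -/
def vertexCycle (hd : 0 < Fintype.card A) :
    Fin (Fintype.card A + 1) ⊕ Fin (Fintype.card A + 1) → π.Cycle
  | Sum.inl k => if h : (k : ℕ) < Fintype.card A then π.cycleOf (π.top.symm ⟨k, h⟩, false)
      else π.cycleOf (π.top.symm ⟨Fintype.card A - 1, Nat.sub_lt hd Nat.one_pos⟩, true)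
  | Sum.inr k => if h : (k : ℕ) < Fintype.card A then π.cycleOf (π.bot.symm ⟨k, h⟩, false)
      else π.cycleOf (π.bot.symm ⟨Fintype.card A - 1, Nat.sub_lt hd Nat.one_pos⟩, true)

lemma vertexCycle_top_succ (hd : 0 < Fintype.card A) (α : A) :
    π.vertexCycle hd (Sum.inl (π.top α).succ) = π.cycleOf (α, true) := by
  by_cases h : (π.top α : ℕ) + 1 < Fintype.card A
  · rw [← cycleOf_sigma, sigma_true_of_lt _ h]
    simp [vertexCycle, h]
  · have h1 : π.top α = ⟨Fintype.card A - 1, Nat.sub_lt hd Nat.one_pos⟩ :=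
      Fin.ext (by have := (π.top α).isLt; simp; omega)
    simp only [vertexCycle, Fin.val_succ, h, dif_neg, not_false_iff, ← h1,
      Equiv.symm_apply_apply]

/-- Each generating identification amounts to at most a few applications of σ; the one at left ends
is already built into the definition of `vertexCycle`. -/
lemma vertexCycle_glue (hd : 0 < Fintype.card A)
    {v w : Fin (Fintype.card A + 1) ⊕ Fin (Fintype.card A + 1)} (h : π.VertexGlue v w) :
    π.vertexCycle hd v = π.vertexCycle hd w := by
  cases h with
  | first =>
    have h : (π.bot (π.bot.symm ⟨0, hd⟩) : ℕ) = 0 := by simp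
    have := π.cycleOf_sigma (π.bot.symm ⟨0, hd⟩, false)
    rw [sigma_false_of_eq _ h] at this
    simpa [vertexCycle, hd] using this
  | last =>
    have h : ¬ (π.top (π.top.symm ⟨Fintype.card A - 1, Nat.sub_lt hd Nat.one_pos⟩) : ℕ) + 1 <
        Fintype.card A := by simp; omega
    have := π.cycleOf_sigma (π.top.symm ⟨Fintype.card A - 1, Nat.sub_lt hd Nat.one_pos⟩, true)
    rw [sigma_true_of_not_lt _ h] at this
    simpa [vertexCycle] using this.symm
  | left α => simp [vertexCycle]
  | right α =>
    rw [vertexCycle_top_succ]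
    by_cases h : (π.bot α : ℕ) + 1 < Fintype.card A
    · have h1 : (π.bot (π.bot.symm ⟨(π.bot α : ℕ) + 1, h⟩) : ℕ) ≠ 0 := by simp
      have := π.cycleOf_sigma (π.bot.symm ⟨(π.bot α : ℕ) + 1, h⟩, false)
      rw [sigma_false_of_ne _ h1] at this
      simpa [vertexCycle, h] using this
    · have h1 : π.bot α = ⟨Fintype.card A - 1, Nat.sub_lt hd Nat.one_pos⟩ :=
        Fin.ext (by have := (π.bot α).isLt; simp; omega)
      simp only [vertexCycle, Fin.val_succ, h, dif_neg, not_false_iff, ← h1,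
        Equiv.symm_apply_apply]

/-- The marked points correspond to the cycles of `σ`. -/
def cycleEquivMarkedPoint (hd : 0 < Fintype.card A) : π.Cycle ≃ π.MarkedPoint where
  toFun := π.liftCycle π.endPoint π.endPoint_sigma
  invFun := Quot.lift (π.vertexCycle hd) fun _ _ h => π.vertexCycle_glue hd h
  left_inv := by
    rintro ⟨α, a⟩
    cases a
    · change π.vertexCycle hd (Sum.inl (π.top α).castSucc) = π.cycleOf (α, false)
      simp [vertexCycle]
    · exact π.vertexCycle_top_succ hd α
  right_inv := by
    have key (k) : π.liftCycle π.endPoint π.endPoint_sigma (π.vertexCycle hd (Sum.inl k)) =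
        Quot.mk _ (Sum.inl k) := by
      by_cases h : (k : ℕ) < Fintype.card A
      · rw [vertexCycle, dif_pos h]
        change π.endPoint _ = _
        simp only [endPoint, Bool.false_eq_true, if_false, Equiv.apply_symm_apply]
        rfl
      · rw [vertexCycle, dif_neg h]
        change π.endPoint _ = _
        simp only [endPoint, if_true, Equiv.apply_symm_apply]
        congr 2
        exact Fin.ext (by simp; omega)
    -- Every marked point is represented by a top vertex, so `key` suffices.
    have exists_top (v) : ∃ k, (Quot.mk π.VertexGlue v) = Quot.mk _ (Sum.inl k) := by
      rcases v with k | k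
      · exact ⟨k, rfl⟩
      · by_cases h : (k : ℕ) < Fintype.card A
        · refine ⟨(π.top (π.bot.symm ⟨k, h⟩)).castSucc, ?_⟩
          rw [Quot.sound (VertexGlue.left _), Equiv.apply_symm_apply]
          rfl
        · refine ⟨Fin.last _, ?_⟩
          rw [Quot.sound VertexGlue.last]
          congr 2
          exact Fin.ext (by simp; omega)
    rintro ⟨v⟩
    obtain ⟨k, hk⟩ := exists_top v
    exact (congrArg (fun q => π.liftCycle _ π.endPoint_sigma (Quot.lift (π.vertexCycle hd)
      (fun _ _ h => π.vertexCycle_glue hd h) q)) hk).trans ((key k).trans hk.symm)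

/-- The relation `d = 2 g + s - 1` between the numbers of letters and of cycles and the genus. -/
lemma card_eq_genus (hd : 0 < Fintype.card A) :
    (Fintype.card A : ℤ) = 2 * π.genus + Nat.card π.Cycle - 1 := by
  -- The parity makes the integer division by 2 in `genus` exact.
  obtain ⟨m, hm⟩ := π.even_card_cycle_add hd
  rw [genus, eulerChar, ← Nat.card_congr (π.cycleEquivMarkedPoint hd)]
  omega

end CombData

/-! ### The top and bottom partitions of the interval. -/

lemma sum_filter_lt_succ {A : Type*} [Fintype A] {n : ℕ} (e : A ≃ Fin n) (f : A → ℝ) (α : A) :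
    ∑ β with (e β : ℕ) < (e α : ℕ) + 1, f β = (∑ β with (e β : ℕ) < (e α : ℕ), f β) + f α := by
  classical
  have : (Finset.univ.filter fun β => (e β : ℕ) < (e α : ℕ) + 1) =
      insert α (Finset.univ.filter fun β => (e β : ℕ) < (e α : ℕ)) := by
    ext β
    simp only [Finset.mem_filter, Finset.mem_univ, true_and, Finset.mem_insert]
    rw [Nat.lt_succ_iff_lt_or_eq, or_comm]
    exact or_congr_left ⟨fun h => e.injective (Fin.ext h), fun h => h ▸ rfl⟩
  rw [this, Finset.sum_insert (by simp), add_comm]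

namespace StandardIEM

variable {A : Type*} [Fintype A] (T : StandardIEM A)

lemma card_pos {A : Type*} [Fintype A] (T : StandardIEM A) : 0 < Fintype.card A :=
  lt_of_lt_of_le Nat.two_pos T.two_le_card

lemma topPt_zero : T.topPt 0 = T.u₀ := by simp [topPt]

lemma botPt_zero : T.botPt 0 = T.u₀ := by simp [botPt]

lemma topPt_card : T.topPt (Fintype.card A) = T.uEnd := by simp [topPt, uEnd]

lemma botPt_card : T.botPt (Fintype.card A) = T.uEnd := by simp [botPt, uEnd]

lemma topRight_eq (α : A) : T.topRight α = T.topLeft α + T.len α := by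
  rw [topRight, topLeft, topPt, topPt, sum_filter_lt_succ, add_assoc]

lemma botPt_succ (α : A) :
    T.botPt ((T.data.bot α : ℕ) + 1) = T.botPt (T.data.bot α) + T.len α := by
  rw [botPt, botPt, sum_filter_lt_succ, add_assoc]

lemma topPt_mono : Monotone T.topPt := fun i j hij => by
  unfold topPt
  refine add_le_add_right ?_ _
  refine Finset.sum_le_sum_of_subset_of_nonneg (fun β hβ => ?_) fun β _ _ => (T.len_pos β).le
  simp only [Finset.mem_filter, Finset.mem_univ, true_and] at hβ ⊢
  omega

lemma botPt_mono : Monotone T.botPt := fun i j hij => by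
  unfold botPt
  refine add_le_add_right ?_ _
  refine Finset.sum_le_sum_of_subset_of_nonneg (fun β hβ => ?_) fun β _ _ => (T.len_pos β).le
  simp only [Finset.mem_filter, Finset.mem_univ, true_and] at hβ ⊢
  omega

lemma topPt_lt {i j : ℕ} (hij : i < j) (hj : j ≤ Fintype.card A) : T.topPt i < T.topPt j := by
  have hi : i < Fintype.card A := by omega
  have h := T.topLeft_lt_topRight (T.data.top.symm ⟨i, hi⟩)
  simp only [topLeft, topRight, Equiv.apply_symm_apply] at h
  exact h.trans_le (T.topPt_mono hij)

lemma botPt_lt {i j : ℕ} (hij : i < j) (hj : j ≤ Fintype.card A) : T.botPt i < T.botPt j := by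
  have hi : i < Fintype.card A := by omega
  have h := T.botPt_succ (T.data.bot.symm ⟨i, hi⟩)
  simp only [Equiv.apply_symm_apply] at h
  have := T.len_pos (T.data.bot.symm ⟨i, hi⟩)
  exact lt_of_lt_of_le (by linarith) (T.botPt_mono hij)

lemma u₀_lt_uEnd : T.u₀ < T.uEnd := by
  rw [← T.topPt_zero, ← T.topPt_card]
  exact T.topPt_lt T.card_pos le_rfl

lemma u₀_le_topLeft (α : A) : T.u₀ ≤ T.topLeft α := by
  rw [← T.topPt_zero]
  exact T.topPt_mono (Nat.zero_le _)

lemma topRight_le_uEnd (α : A) : T.topRight α ≤ T.uEnd := by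
  rw [← T.topPt_card]
  exact T.topPt_mono (T.data.top α).isLt

lemma topInterval_subset (α : A) : T.topInterval α ⊆ Set.Ioo T.u₀ T.uEnd :=
  Set.Ioo_subset_Ioo (T.u₀_le_topLeft α) (T.topRight_le_uEnd α)

lemma eq_of_mem_topInterval {α β : A} {x : ℝ} (hα : x ∈ T.topInterval α)
    (hβ : x ∈ T.topInterval β) : α = β := by
  have key {α β : A} (hα : x ∈ T.topInterval α) (hβ : x ∈ T.topInterval β) :
      ¬ (T.data.top α : ℕ) < T.data.top β := fun h =>
    absurd ((hα.2.trans_le (T.topPt_mono h)).trans hβ.1) (lt_irrefl x)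
  exact T.data.top.injective
    (Fin.ext (le_antisymm (not_lt.1 (key hβ hα)) (not_lt.1 (key hα hβ))))

lemma letter_eq {α : A} (x : T.domain) (hx : (x : ℝ) ∈ T.topInterval α) : T.letter x = α :=
  T.eq_of_mem_topInterval (T.mem_letter x) hx

lemma map_eq {α : A} (x : T.domain) (hx : (x : ℝ) ∈ T.topInterval α) :
    T.map x = x + T.shift α := by
  rw [map, T.letter_eq x hx]

lemma map_mem_Ioo_botPt {α : A} (x : T.domain) (hx : (x : ℝ) ∈ T.topInterval α) :
    T.map x ∈ Set.Ioo (T.botPt (T.data.bot α)) (T.botPt ((T.data.bot α : ℕ) + 1)) := by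
  have h1 := hx.1
  have h2 := hx.2
  rw [topRight_eq] at h2
  rw [T.map_eq x hx, botPt_succ, shift]
  unfold topLeft at h1 h2
  constructor <;> linarith

lemma map_mem_Ioo (x : T.domain) : T.map x ∈ Set.Ioo T.u₀ T.uEnd := by
  have h := T.map_mem_Ioo_botPt x (T.mem_letter x)
  rw [← T.botPt_zero, ← T.botPt_card]
  exact Set.Ioo_subset_Ioo (T.botPt_mono (Nat.zero_le _)) (T.botPt_mono (Fin.isLt _)) h

lemma exists_mem_topInterval {x : ℝ} (hx : x ∈ Set.Icc T.u₀ T.uEnd)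
    (h : ∀ k ≤ Fintype.card A, x ≠ T.topPt k) : ∃ α, x ∈ T.topInterval α := by
  classical
  have hex : ∃ k, k ≤ Fintype.card A ∧ x < T.topPt k :=
    ⟨Fintype.card A, le_rfl, lt_of_le_of_ne (by rw [topPt_card]; exact hx.2) (h _ le_rfl)⟩
  obtain ⟨hk, hxk⟩ := Nat.find_spec hex
  have hmin := fun m => Nat.find_min hex (m := m)
  obtain hk0 | ⟨k, hk'⟩ := Nat.eq_zero_or_eq_succ_pred (Nat.find hex) |>.imp id
    fun h => (⟨_, h⟩ : ∃ k, Nat.find hex = Nat.succ k)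
  · rw [hk0, topPt_zero] at hxk
    exact absurd hx.1 (not_le.2 hxk)
  · rw [hk'] at hk hxk
    have hk1 : k < Fintype.card A := hk
    have := hmin k (by omega)
    push Not at this
    refine ⟨T.data.top.symm ⟨k, hk1⟩, ?_, ?_⟩
    · simp only [topLeft, Equiv.apply_symm_apply]
      exact lt_of_le_of_ne (this hk1.le) (h k hk1.le).symm
    · simpa only [topRight, Equiv.apply_symm_apply] using hxk

/-- The first letter of the bottom row is not the first one of the top row, and likewise for the
last letters. -/
lemma bot_ne_zero {α : A} (h : (T.data.top α : ℕ) = 0) : (T.data.bot α : ℕ) ≠ 0 := by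
  intro h'
  refine T.irreducible 1 le_rfl T.two_le_card ?_
  ext β
  simp only [Set.mem_ofPred_eq, Nat.lt_one_iff]
  constructor <;> intro hβ
  · rw [T.data.top.injective (Fin.ext (hβ.trans h.symm)), h']
  · rw [T.data.bot.injective (Fin.ext (hβ.trans h'.symm)), h]

lemma top_succ_lt {α : A} (h : (T.data.bot α : ℕ) + 1 = Fintype.card A) :
    (T.data.top α : ℕ) + 1 < Fintype.card A := by
  by_contra h'
  have h2 := T.two_le_card
  have h3 := (T.data.top α).isLt
  refine T.irreducible (Fintype.card A - 1) (by omega) (by omega) ?_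
  ext β
  simp only [Set.mem_ofPred_eq]
  have ht := (T.data.top β).isLt
  have hb := (T.data.bot β).isLt
  by_cases hβ : β = α
  · subst hβ; omega
  · have h4 : (T.data.top β : ℕ) ≠ T.data.top α := fun h =>
      hβ (T.data.top.injective (Fin.ext h))
    have h5 : (T.data.bot β : ℕ) ≠ T.data.bot α := fun h =>
      hβ (T.data.bot.injective (Fin.ext h))
    omega

/-! ### Rigidity of functions on the cycles. -/

/-- A function on the cycles whose increments along the letters are proportional to the lengths
is constant. -/
lemma const_of_increment {y : T.data.Cycle → ℝ} {c : ℝ}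
    (h : ∀ α, y (T.data.cycleOf (α, true)) - y (T.data.cycleOf (α, false)) = c * T.len α) :
    c = 0 ∧ ∃ y₀, ∀ C, y C = y₀ := by
  set y₀ := y (T.data.cycleOf (T.data.top.symm ⟨0, T.card_pos⟩, false)) with hy₀
  -- Starting from the common first vertex, y is affine of slope c in the position along the top
  -- path, and likewise along the bottom path.
  have htop : ∀ n (hn : n < Fintype.card A),
      y (T.data.cycleOf (T.data.top.symm ⟨n, hn⟩, false)) = y₀ + c * (T.topPt n - T.u₀) := by
    intro n
    induction n with
    | zero => intro hn; simp [topPt_zero, hy₀]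
    | succ n ih =>
      intro hn
      have h1 := ih (by omega)
      set α := T.data.top.symm ⟨n, by omega⟩ with hα
      have hα' : (T.data.top α : ℕ) = n := by simp [hα]
      have h2 := T.data.cycleOf_sigma (α, true)
      rw [T.data.sigma_true_of_lt (by omega)] at h2
      have h3 := T.topRight_eq α
      simp only [topRight, topLeft, hα'] at h2 h3
      rw [h2, h3]
      linarith [h α]
  have hbot : ∀ n (hn : n < Fintype.card A),
      y (T.data.cycleOf (T.data.bot.symm ⟨n, hn⟩, true)) =
        y₀ + c * (T.botPt (n + 1) - T.u₀) := by
    intro n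
    induction n with
    | zero =>
      intro hn
      set α := T.data.bot.symm ⟨0, hn⟩ with hα
      have hα' : (T.data.bot α : ℕ) = 0 := by simp [hα]
      have h2 := T.data.cycleOf_sigma (α, false)
      rw [T.data.sigma_false_of_eq hα'] at h2
      have h3 := T.botPt_succ α
      rw [hα', botPt_zero] at h3
      rw [zero_add] at h3 ⊢
      have := h α
      rw [← h2] at this
      rw [h3]
      linarith
    | succ n ih =>
      intro hn
      have h1 := ih (by omega)
      set α := T.data.bot.symm ⟨n + 1, hn⟩ with hα
      have hα' : (T.data.bot α : ℕ) = n + 1 := by simp [hα]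
      have h2 := T.data.cycleOf_sigma (α, false)
      rw [T.data.sigma_false_of_ne (by omega)] at h2
      simp only [hα', Nat.add_sub_cancel] at h2
      have h3 := T.botPt_succ α
      rw [hα'] at h3
      rw [h3]
      rw [h2] at h1
      linarith [h α]
  -- The right end of the last bottom letter sits at `uEnd` on the bottom path but, by
  -- irreducibility, strictly to the left of it on the top path. The two values of y there agree
  -- only if c = 0.
  have hc : c = 0 := by
    have hd := T.card_pos
    set α := T.data.bot.symm ⟨Fintype.card A - 1, by omega⟩ with hα
    have hα' : (T.data.bot α : ℕ) + 1 = Fintype.card A := by simp [hα]; omega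
    have h1 := hbot (Fintype.card A - 1) (by omega)
    rw [show Fintype.card A - 1 + 1 = Fintype.card A by omega, botPt_card, ← hα] at h1
    have h2 := htop _ (T.data.top α).isLt
    simp only [Fin.eta, Equiv.symm_apply_apply] at h2
    have h3 := T.topRight_eq α
    have h4 : T.topRight α < T.uEnd := by
      rw [← topPt_card]
      exact T.topPt_lt (T.top_succ_lt hα') le_rfl
    have h5 : c * (T.uEnd - T.topRight α) = 0 := by
      rw [h3, topLeft]; linarith [h α]
    exact (mul_eq_zero.1 h5).resolve_right (by linarith)
  refine ⟨hc, y₀, ?_⟩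
  have hleft (α) : y (T.data.cycleOf (α, false)) = y₀ := by
    have := htop _ (T.data.top α).isLt
    simpa [hc] using this
  rintro ⟨α, a⟩
  cases a
  · exact hleft α
  · have := h α
    rw [hc, zero_mul, hleft, sub_eq_zero] at this
    exact this

/-! ### Piecewise polynomial functions and the dimension of Γ(r). -/

instance finite_degreeLT (r : ℕ) : Module.Finite ℝ (degreeLT ℝ r) :=
  Module.Finite.equiv (degreeLTEquiv ℝ r).symm

lemma finrank_degreeLT (r : ℕ) : Module.finrank ℝ (degreeLT ℝ r) = r := by
  rw [(degreeLTEquiv ℝ r).finrank_eq, Module.finrank_fin_fun]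

/-- The function that is given by a polynomial on each top interval. -/
def ofPoly (r : ℕ) : (A → degreeLT ℝ r) →ₗ[ℝ] T.Fn where
  toFun P x := (P (T.letter x) : ℝ[X]).eval (x : ℝ)
  map_add' P Q := by ext x; simp
  map_smul' c P := by ext x; simp

lemma ofPoly_apply {r : ℕ} (P : A → degreeLT ℝ r) {α : A} (x : T.domain)
    (hx : (x : ℝ) ∈ T.topInterval α) : T.ofPoly r P x = (P α : ℝ[X]).eval (x : ℝ) := by
  rw [← T.letter_eq x hx]; rfl

lemma ofPoly_injective (r : ℕ) : Function.Injective (T.ofPoly r) := by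
  intro P Q h
  ext1 α
  apply Subtype.ext
  refine Polynomial.eq_of_infinite_eval_eq _ _ ((Set.Ioo_infinite
    (T.topLeft_lt_topRight α)).mono fun x hx => ?_)
  have hx' : x ∈ T.topInterval α := hx
  have := congrFun h ⟨x, T.mem_domain hx'⟩
  rwa [T.ofPoly_apply P ⟨x, T.mem_domain hx'⟩ hx',
    T.ofPoly_apply Q ⟨x, T.mem_domain hx'⟩ hx'] at this

lemma mem_GamPoly_of {r : ℕ} {χ : T.Fn} (h : ∀ α, ∃ p : ℝ[X], p.degree < (r : WithBot ℕ) ∧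
    ∀ x : T.domain, (x : ℝ) ∈ T.topInterval α → χ x = p.eval (x : ℝ)) : χ ∈ T.GamPoly r := by
  refine ⟨fun α => ?_, h⟩
  obtain ⟨p, -, hp⟩ := h α
  exact ⟨fun x => p.eval x, (by simpa using (p.contDiff_aeval (𝕜 := ℝ) ∞).contDiffOn), hp⟩

lemma range_ofPoly (r : ℕ) : LinearMap.range (T.ofPoly r) = T.GamPoly r := by
  ext χ
  constructor
  · rintro ⟨P, rfl⟩
    exact T.mem_GamPoly_of fun α => ⟨P α, mem_degreeLT.1 (P α).2, T.ofPoly_apply P⟩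
  · rintro ⟨-, h⟩
    choose p hp hp' using h
    refine ⟨fun α => ⟨p α, mem_degreeLT.2 (hp α)⟩, ?_⟩
    ext x
    exact (hp' _ x (T.mem_letter x)).symm

lemma finrank_GamPoly (r : ℕ) : Module.finrank ℝ (T.GamPoly r) = r * Fintype.card A := by
  rw [← range_ofPoly, LinearMap.finrank_range_of_inj (T.ofPoly_injective r),
    Module.finrank_pi_fintype]
  simp [finrank_degreeLT, mul_comm]

instance finite_GamPoly (r : ℕ) : Module.Finite ℝ (T.GamPoly r) := by
  rw [← range_ofPoly]; infer_instance

lemma iterate_D_ofPoly {r : ℕ} (P : A → degreeLT ℝ r) (i : ℕ) {α : A} (x : T.domain)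
    (hx : (x : ℝ) ∈ T.topInterval α) :
    T.D^[i] (T.ofPoly r P) x = (derivative^[i] (P α : ℝ[X])).eval (x : ℝ) := by
  induction i generalizing x with
  | zero => exact T.ofPoly_apply P x hx
  | succ i ih =>
    rw [Function.iterate_succ_apply', Function.iterate_succ_apply']
    exact T.D_eq_eval (fun y hy => ih y hy) x hx

lemma endVal_eq_eval {φ : T.Fn} {p : ℝ[X]} {υ : A × Bool}
    (h : ∀ x : T.domain, (x : ℝ) ∈ T.topInterval υ.1 → φ x = p.eval (x : ℝ)) :
    T.endVal φ υ = p.eval (T.endpoint υ) := by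
  refine Tendsto.limUnder_eq ?_
  have h1 : Tendsto (fun x : T.domain => p.eval (x : ℝ)) (T.endFilter υ)
      (𝓝 (p.eval (T.endpoint υ))) :=
    ((p.continuous.tendsto _).mono_left nhdsWithin_le_nhds).comp tendsto_comap
  refine h1.congr' ?_
  have h3 : ∀ᶠ x : T.domain in T.endFilter υ, (x : ℝ) ∈ T.topInterval υ.1 :=
    tendsto_comap.eventually self_mem_nhdsWithin
  filter_upwards [h3] with x hx
  exact (h x hx).symm

/-! ### Rank of the boundary operator and the dimension of Γ_∂(r). -/

open scoped Classical in
lemma sum_sum_cycleOf_eq [Fintype T.data.Cycle] (f : A × Bool → ℝ) :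
    ∑ C, ∑ υ with T.data.cycleOf υ = C, f υ = ∑ υ, f υ := by
  rw [← Finset.sum_fiberwise Finset.univ T.data.cycleOf f]

open scoped Classical in
/-- The boundaries of all the derivatives of a piecewise polynomial function. -/
def bdryPoly (r : ℕ) : (A → degreeLT ℝ r) →ₗ[ℝ] (Fin r × T.data.Cycle → ℝ) where
  toFun P c := ∑ υ with T.data.cycleOf υ = c.2,
    sgn υ * (derivative^[c.1] (P υ.1 : ℝ[X])).eval (T.endpoint υ)
  map_add' P Q := by
    ext c
    simp [mul_add, Finset.sum_add_distrib]
  map_smul' a P := by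
    ext c
    simp [Polynomial.iterate_derivative_smul, Finset.mul_sum, mul_left_comm]

lemma bdry_iterate_D_ofPoly {r : ℕ} (P : A → degreeLT ℝ r) (i : Fin r) (C : T.data.Cycle) :
    T.bdry (T.D^[i] (T.ofPoly r P)) C = T.bdryPoly r P (i, C) := by
  unfold bdry bdryPoly
  refine Finset.sum_congr rfl fun υ _ => ?_
  rw [T.endVal_eq_eval fun x hx => T.iterate_D_ofPoly P i x hx]

lemma map_ker_bdryPoly (r : ℕ) :
    (LinearMap.ker (T.bdryPoly r)).map (T.ofPoly r) = T.GamBdry r := by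
  ext χ
  constructor
  · rintro ⟨P, hP, rfl⟩
    refine ⟨by rw [← range_ofPoly]; exact ⟨P, rfl⟩, fun i hi => funext fun C => ?_⟩
    rw [T.bdry_iterate_D_ofPoly P ⟨i, hi⟩ C, LinearMap.mem_ker.1 hP]
    rfl
  · rintro ⟨h1, h2⟩
    rw [← range_ofPoly] at h1
    obtain ⟨P, rfl⟩ := h1
    refine ⟨P, LinearMap.mem_ker.2 (funext fun c => ?_), rfl⟩
    rw [← bdry_iterate_D_ofPoly, h2 _ c.1.isLt]
    rfl

/-- The pairing of the boundary map with a vector, tested on a function that vanishes on all but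
one of the intervals. -/
lemma sum_mul_bdryPoly_single [DecidableEq A] [Fintype T.data.Cycle] {r : ℕ}
    (x : Fin r × T.data.Cycle → ℝ) (α : A) (p : degreeLT ℝ r) :
    ∑ c, x c * T.bdryPoly r (Pi.single α p) c =
      ∑ i : Fin r, (x (i, T.data.cycleOf (α, true)) *
          (derivative^[i] (p : ℝ[X])).eval (T.topRight α) -
        x (i, T.data.cycleOf (α, false)) * (derivative^[i] (p : ℝ[X])).eval (T.topLeft α)) := by
  classical
  rw [Fintype.sum_prod_type]
  refine Finset.sum_congr rfl fun i _ => ?_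
  have h1 : ∀ C : T.data.Cycle, x (i, C) * T.bdryPoly r (Pi.single α p) (i, C) =
      ∑ υ with T.data.cycleOf υ = C, x (i, T.data.cycleOf υ) * (sgn υ *
        (derivative^[i] ((Pi.single α p : A → degreeLT ℝ r) υ.1 : ℝ[X])).eval
          (T.endpoint υ)) := by
    intro C
    unfold bdryPoly
    simp only [LinearMap.coe_mk, AddHom.coe_mk, Finset.mul_sum]
    refine Finset.sum_congr (by congr) fun υ hυ => ?_
    rw [(Finset.mem_filter.1 hυ).2]
  simp only [h1]
  rw [sum_sum_cycleOf_eq, Fintype.sum_prod_type, Finset.sum_eq_single α]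
  · simp [sgn, endpoint]
    ring
  · intro β _ hβ
    simp [Pi.single_eq_of_ne hβ]
  · simp

/-- The vectors that annihilate the range of the boundary map. -/
lemma annihilator_bdryPoly [Fintype T.data.Cycle] {r : ℕ} {x : Fin r × T.data.Cycle → ℝ}
    (h : ∀ P, ∑ c, x c * T.bdryPoly r P c = 0) (i : ℕ) (hi : i < r) :
    ∃ y₀, (∀ C, x (⟨i, hi⟩, C) = y₀) ∧ (i + 1 < r → y₀ = 0) := by
  classical
  induction i using Nat.strong_induction_on with
  | _ i ih =>
  -- Every level j < i satisfies j + 1 < r, so its constant vanishes by induction.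
  have hz : ∀ j (hj : j < i) C, x (⟨j, hj.trans hi⟩, C) = 0 := by
    intro j hj C
    obtain ⟨y, hy, hy'⟩ := ih j hj (hj.trans hi)
    rw [hy, hy' (by omega)]
  have test (α : A) (p : degreeLT ℝ r) := (T.sum_mul_bdryPoly_single x α p).symm.trans (h _)
  have mem {n : ℕ} (hn : n < r) : (X ^ n : ℝ[X]) ∈ degreeLT ℝ r := by
    rw [mem_degreeLT, degree_X_pow]; exact_mod_cast hn
  have h0 : ∀ α, x (⟨i, hi⟩, T.data.cycleOf (α, true)) -
      x (⟨i, hi⟩, T.data.cycleOf (α, false)) = 0 * T.len α := by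
    intro α
    -- Levels above i kill X^i and those below i carry zero coefficients; what remains is i! times
    -- the increment of x(i, ·).
    have := test α ⟨X ^ i, mem hi⟩
    rw [Finset.sum_eq_single ⟨i, hi⟩] at this
    · simp only [iterate_derivative_X_pow_eq_natCast_mul, Nat.descFactorial_self, Nat.sub_self,
        pow_zero, mul_one, eval_natCast, ← sub_mul, mul_eq_zero, Nat.cast_eq_zero,
        Nat.factorial_ne_zero, or_false] at this
      rw [this, zero_mul]
    · intro j _ hj
      rcases lt_trichotomy (j : ℕ) i with hji | hji | hji
      · have h1 := hz j hji
        simp only [Fin.eta] at h1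
        simp [h1]
      · exact absurd (Fin.ext hji) hj
      · rw [iterate_derivative_eq_zero (by rw [natDegree_X_pow]; exact hji)]
        simp
    · simp
  obtain ⟨-, y₀, hy⟩ := T.const_of_increment (y := fun C => x (⟨i, hi⟩, C)) h0
  refine ⟨y₀, hy, fun hi' => ?_⟩
  have h1 : ∀ α, x (⟨i + 1, hi'⟩, T.data.cycleOf (α, true)) -
      x (⟨i + 1, hi'⟩, T.data.cycleOf (α, false)) = -y₀ * T.len α := by
    intro α
    -- Only levels i and i + 1 contribute: (i+1)! times the increment of x(i+1, ·) plus y₀ times the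
    -- length. Rigidity with slope -y₀ then gives y₀ = 0.
    have := test α ⟨X ^ (i + 1), mem hi'⟩
    rw [Finset.sum_eq_add ⟨i, hi⟩ ⟨i + 1, hi'⟩] at this
    · simp only [iterate_derivative_X_pow_eq_natCast_mul, Nat.descFactorial_self, Nat.sub_self,
        pow_zero, mul_one, eval_natCast, hy, eval_mul, Nat.add_sub_cancel_left, pow_one, eval_X,
        T.topRight_eq α] at this
      have h2 : Nat.descFactorial (i + 1) i = (i + 1).factorial := by
        have := Nat.factorial_mul_descFactorial (Nat.le_succ i)
        simpa using this
      rw [h2] at this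
      have h3 : ((i + 1).factorial : ℝ) ≠ 0 := by exact_mod_cast Nat.factorial_ne_zero _
      apply mul_left_cancel₀ h3
      linear_combination this
    · simp
    · rintro j - ⟨hj, hj'⟩
      rcases lt_trichotomy (j : ℕ) i with hji | hji | hji
      · have h1 := hz j hji
        simp only [Fin.eta] at h1
        simp [h1]
      · exact absurd (Fin.ext hji) hj
      · have : (j : ℕ) ≠ i + 1 := fun h => hj' (Fin.ext h)
        rw [iterate_derivative_eq_zero (by rw [natDegree_X_pow]; omega)]
        simp
    · simp
    · simp
  simpa using (T.const_of_increment (y := fun C => x (⟨i + 1, hi'⟩, C)) h1).1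

/-- The derivative of order r - 1 is constant on each interval, so the contributions of its two ends
cancel. Up to scaling this is the only linear relation on the range. -/
lemma sum_bdryPoly_last [Fintype T.data.Cycle] {r : ℕ} (hr : r - 1 < r) (P : A → degreeLT ℝ r) :
    ∑ C, T.bdryPoly r P (⟨r - 1, hr⟩, C) = 0 := by
  classical
  unfold bdryPoly
  simp only [LinearMap.coe_mk, AddHom.coe_mk]
  rw [sum_sum_cycleOf_eq, Fintype.sum_prod_type]
  refine Finset.sum_eq_zero fun α _ => ?_
  have hdeg : (derivative^[r - 1] (P α : ℝ[X])).natDegree = 0 := by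
    have h1 := natDegree_iterate_derivative (P α : ℝ[X]) (r - 1)
    have h2 : (P α : ℝ[X]).natDegree ≤ r - 1 := by
      rcases eq_or_ne (P α : ℝ[X]) 0 with h0 | h0
      · simp [h0]
      · have := (natDegree_lt_iff_degree_lt h0).2 (mem_degreeLT.1 (P α).2)
        omega
    omega
  simp only
  rw [eq_C_of_natDegree_eq_zero hdeg]
  simp [sgn]

/-- The annihilator of the range is the kernel of the dual map. It is the line spanned by the sum
`v` of the components of order r - 1. -/
lemma finrank_range_bdryPoly {r : ℕ} (hr : 1 ≤ r) :
    Module.finrank ℝ (LinearMap.range (T.bdryPoly r)) + 1 = r * Nat.card T.data.Cycle := by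
  classical
  have : Fintype T.data.Cycle := Fintype.ofFinite _
  have hr' : r - 1 < r := by omega
  have h1 := LinearMap.finrank_range_add_finrank_ker (T.bdryPoly r).dualMap
  rw [LinearMap.finrank_range_dualMap_eq_finrank_range, Subspace.dual_finrank_eq,
    Module.finrank_fintype_fun_eq_card, Fintype.card_prod, Fintype.card_fin,
    ← Nat.card_eq_fintype_card] at h1
  rw [← h1]
  congr 1
  let v : Module.Dual ℝ (Fin r × T.data.Cycle → ℝ) :=
    ∑ C, LinearMap.proj (R := ℝ) (φ := fun _ => ℝ) ((⟨r - 1, hr'⟩, C) : Fin r × T.data.Cycle)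
  have hv : v ∈ LinearMap.ker (T.bdryPoly r).dualMap := by
    refine LinearMap.mem_ker.2 (LinearMap.ext fun P => ?_)
    simpa [v] using T.sum_bdryPoly_last hr' P
  symm
  rw [finrank_eq_one_iff_of_nonzero' (⟨v, hv⟩ : LinearMap.ker (T.bdryPoly r).dualMap)]
  · rintro ⟨f, hf⟩
    have hf_eq (w : Fin r × T.data.Cycle → ℝ) :
        f w = ∑ c, f (Pi.single c 1) * w c := by
      conv_lhs => rw [pi_eq_sum_univ' w]
      simp only [map_sum, map_smul, smul_eq_mul]
      refine Finset.sum_congr rfl fun c _ => ?_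
      rw [mul_comm]
    have key := T.annihilator_bdryPoly (x := fun c => f (Pi.single c 1)) fun P => by
      rw [← hf_eq]
      exact LinearMap.congr_fun (LinearMap.mem_ker.1 hf) P
    obtain ⟨y, hy, -⟩ := key (r - 1) hr'
    refine ⟨y, Subtype.ext (LinearMap.ext fun w => ?_)⟩
    change y * v w = f w
    rw [hf_eq, Fintype.sum_prod_type, Finset.sum_eq_single ⟨r - 1, hr'⟩]
    · simp [v, hy, Finset.mul_sum]
    · intro j _ hj
      obtain ⟨y', hy', h0⟩ := key j j.isLt
      refine Finset.sum_eq_zero fun C _ => ?_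
      have hj' : (j : ℕ) ≠ r - 1 := fun h => hj (Fin.ext h)
      have := hy' C
      simp only [Fin.eta] at this
      rw [this, h0 (by have := j.isLt; omega), zero_mul]
    · simp
  · intro h0
    have h2 : v (Pi.single (⟨r - 1, hr'⟩, T.data.cycleOf (T.data.top.symm ⟨0, T.card_pos⟩, true))
        1) = 0 := by
      rw [show v = 0 from congrArg Subtype.val h0]; rfl
    simp [v, Pi.single_apply] at h2

lemma finrank_GamBdry {r : ℕ} (hr : 1 ≤ r) :
    (Module.finrank ℝ (T.GamBdry r) : ℤ) = (2 * T.data.genus - 1) * r + 1 := by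
  have h1 := LinearMap.finrank_range_add_finrank_ker (T.bdryPoly r)
  have h2 := T.finrank_range_bdryPoly hr
  have h3 : Module.finrank ℝ (A → degreeLT ℝ r) = r * Fintype.card A := by
    rw [Module.finrank_pi_fintype]
    simp [finrank_degreeLT, mul_comm]
  have h4 := T.data.card_eq_genus T.card_pos
  rw [← map_ker_bdryPoly,
    (Submodule.equivMapOfInjective _ (T.ofPoly_injective r) _).symm.finrank_eq]
  rw [h3] at h1
  zify at h1 h2
  linear_combination h1 - h2 + (r : ℤ) * h4

/-! ### Absence of connections and continuous invariant functions. -/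

lemma topRight_add_shift (α : A) :
    T.topRight α + T.shift α = T.botPt ((T.data.bot α : ℕ) + 1) := by
  rw [topRight_eq, botPt_succ, shift, topLeft]
  ring

lemma step_of_mem {α : A} {x : ℝ} (hx : x ∈ T.topInterval α) : T.Step x (x + T.shift α) :=
  ⟨T.mem_domain hx, T.map_eq ⟨x, T.mem_domain hx⟩ hx⟩

/-- A periodic orbit forces a connection. -/
lemma hasConnection_of_periodic {x : ℕ → ℝ} {a : ℕ → A} (hx : ∀ n, x n ∈ T.topInterval (a n))
    (hstep : ∀ n, x (n + 1) = x n + T.shift (a n)) {p : ℕ} (hp : 0 < p)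
    (hper : ∀ n, x (n + p) = x n) : T.HasConnection := by
  have haper : ∀ n, a (n + p) = a n := fun n =>
    T.eq_of_mem_topInterval (hx (n + p)) (by rw [hper]; exact hx n)
  let g : ℕ → ℝ := fun n => T.topRight (a n) - x n
  have hg : Function.Periodic g p := fun n => by simp only [g, haper, hper]
  obtain ⟨k₀, -, hk₀⟩ := Finset.exists_min_image (Finset.range p) g ⟨0, by simpa using hp⟩
  -- The periodic orbit is pushed to the right by `t`, the largest amount for which no point passes
  -- the right endpoint of its interval; at time `k₀` the endpoint is reached. `S n` records such a
  -- hit.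
  set t := g k₀ with ht
  have htle : ∀ n, t ≤ g n := fun n => by
    rw [← hg.map_mod_nat n]
    exact hk₀ _ (Finset.mem_range.2 (Nat.mod_lt _ hp))
  have htpos : 0 < t := sub_pos.2 (hx k₀).2
  let y : ℕ → ℝ := fun n => x n + t
  let S : ℕ → Prop := fun n => y n = T.topRight (a n)
  have hyper : ∀ n, y (n + p) = y n := fun n => by simp only [y, hper]
  have hSper : ∀ n, S n → S (n + p) := fun n hn => by
    simpa only [S, hyper, haper] using hn
  have hyle : ∀ n, y n ≤ T.topRight (a n) := fun n => by
    have := htle n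
    simp only [g] at this
    simp only [y]
    linarith
  have hystep : ∀ n, y (n + 1) = y n + T.shift (a n) := fun n => by
    simp only [y, hstep]; ring
  have hmem : ∀ n, ¬ S n → y n ∈ T.topInterval (a n) := fun n hn =>
    ⟨(hx n).1.trans (by simp only [y]; linarith), lt_of_le_of_ne (hyle n) hn⟩
  have hS : ∀ n, S n → y (n + 1) = T.botPt ((T.data.bot (a n) : ℕ) + 1) := fun n hn => by
    rw [hystep, show y n = _ from hn, topRight_add_shift]
  -- `uEnd` is not an admissible singularity. It is reached only right after a hit, and never twice
  -- in a row, since the last top and bottom letters differ.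
  have hend : ∀ n, y (n + 1) = T.uEnd → S n ∧ y n ≠ T.uEnd := by
    intro n hn
    have hSn : S n := by
      by_contra h
      have := (T.map_mem_Ioo ⟨y n, T.mem_domain (hmem n h)⟩).2
      rw [T.map_eq ⟨y n, T.mem_domain (hmem n h)⟩ (hmem n h), ← hystep, hn] at this
      exact lt_irrefl _ this
    refine ⟨hSn, ?_⟩
    have hb : (T.data.bot (a n) : ℕ) + 1 = Fintype.card A := by
      by_contra h
      have h2 := T.botPt_lt (lt_of_le_of_ne (T.data.bot (a n)).isLt h) le_rfl
      rw [botPt_card, ← hS n hSn, hn] at h2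
      exact lt_irrefl _ h2
    rw [show y n = _ from hSn, ← topPt_card]
    exact (T.topPt_lt (T.top_succ_lt hb) le_rfl).ne
  obtain ⟨k, hSk, hk⟩ : ∃ k, S k ∧ y (k + 1) ≠ T.uEnd := by
    have h0 : S k₀ := by simp only [S, y, ht, g]; ring
    by_cases h : y (k₀ + 1) = T.uEnd
    · refine ⟨k₀ + 1, ?_, fun h' => (hend _ h').2 h⟩
      exact le_antisymm (hyle _) (h ▸ T.topRight_le_uEnd _)
    · exact ⟨k₀, h0, h⟩
  classical
  -- The point after the hit at `k` is some uᵇ_j with 0 < j < d. By periodicity a further hit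
  -- follows, and the first one is a uᵗ_i; before it T is defined along the pushed orbit.
  have hex : ∃ m, S (k + 1 + m) :=
    ⟨p - 1, by rw [show k + 1 + (p - 1) = k + p by omega]; exact hSper k hSk⟩
  have hmin : ∀ m < Nat.find hex, ¬ S (k + 1 + m) := fun m => Nat.find_min hex
  have hSl := Nat.find_spec hex
  set l := Nat.find hex
  have hl : y (k + 1 + l) ≠ T.uEnd := by
    intro h
    rcases Nat.eq_zero_or_eq_succ_pred l with h0 | h1
    · rw [h0] at h; exact hk h
    · rw [h1] at h
      exact hmin (Nat.pred l) (by omega) (hend _ h).1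
  refine ⟨(T.data.top (a (k + 1 + l)) : ℕ) + 1, (T.data.bot (a k) : ℕ) + 1, by omega,
    lt_of_le_of_ne (Fin.isLt _) fun h => hl ?_, by omega,
    lt_of_le_of_ne (Fin.isLt _) fun h => hk ?_, ?_⟩
  · rw [show y _ = _ from hSl, topRight, h, topPt_card]
  · rw [hS k hSk, h, botPt_card]
  · rw [← hS k hSk]
    change Relation.ReflTransGen T.Step _ (T.topRight (a (k + 1 + l)))
    rw [← show y _ = _ from hSl]
    have : ∀ m ≤ l, Relation.ReflTransGen T.Step (y (k + 1)) (y (k + 1 + m)) := by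
      intro m
      induction m with
      | zero => intro _; exact Relation.ReflTransGen.refl
      | succ m ih =>
        intro hm
        refine (ih (by omega)).tail ?_
        have := T.step_of_mem (hmem _ (hmin m (by omega)))
        rwa [← hystep] at this
    exact this l le_rfl

/-- A sequence in a bounded interval with the property that two of its terms are equal or at least
`δ` apart takes some value twice. -/
lemma exists_eq_of_separated {x : ℕ → ℝ} {u v δ : ℝ} (hδ : 0 < δ)
    (hx : ∀ n, x n ∈ Set.Icc u v) (hsep : ∀ m n, x m < x n → δ ≤ x n - x m) :
    ∃ m n, m < n ∧ x m = x n := by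
  -- Pigeonhole on cells of length δ: two terms in one cell are less than δ apart, hence equal.
  have hlt (n) : ⌊(x n - u) / δ⌋₊ < ⌊(v - u) / δ⌋₊ + 1 := by
    refine Nat.lt_succ_of_le (Nat.floor_le_floor ?_)
    have := (hx n).2
    gcongr
  obtain ⟨m, n, hmn, h⟩ := Finite.exists_ne_map_eq_of_infinite
    fun n => (⟨_, hlt n⟩ : Fin (⌊(v - u) / δ⌋₊ + 1))
  have key {m n : ℕ} (h : ⌊(x m - u) / δ⌋₊ = ⌊(x n - u) / δ⌋₊) : ¬ x m < x n := by
    intro hlt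
    have h1 := Nat.floor_le (div_nonneg (sub_nonneg.2 (hx m).1) hδ.le)
    have h2 := Nat.lt_floor_add_one ((x n - u) / δ)
    rw [h] at h1
    rw [le_div_iff₀ hδ] at h1
    rw [div_lt_iff₀ hδ] at h2
    have := hsep _ _ hlt
    linarith
  have h' := Fin.mk.inj h
  have heq : x m = x n := le_antisymm (not_lt.1 (key h'.symm)) (not_lt.1 (key h'))
  rcases hmn.lt_or_gt with h | h
  · exact ⟨m, n, h, heq⟩
  · exact ⟨n, m, h, heq.symm⟩

/-- Without connections, a continuous invariant function is constant. -/
lemma eq_of_continuousOn_of_invariant (hT : ¬ T.HasConnection) {ψ : ℝ → ℝ}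
    (hψ : ContinuousOn ψ (Set.Icc T.u₀ T.uEnd)) (hinv : ∀ x : T.domain, ψ (T.map x) = ψ x)
    {x y : ℝ} (hx : x ∈ Set.Icc T.u₀ T.uEnd) (hy : y ∈ Set.Icc T.u₀ T.uEnd) : ψ x = ψ y := by
  classical
  by_contra hne
  apply hT
  have hinv' {α : A} {z : ℝ} (hz : z ∈ T.topInterval α) : ψ (z + T.shift α) = ψ z := by
    rw [← hinv ⟨z, T.mem_domain hz⟩, T.map_eq ⟨z, T.mem_domain hz⟩ hz]
  let F : Set ℝ := T.topPt '' Set.Iic (Fintype.card A)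
  have hF : F.Finite := (Set.finite_Iic _).image _
  -- The level set `L` of such a value is compact, nonempty and T-invariant, and stays at distance
  -- at least δ from all the points uᵗ_k.
  obtain ⟨c, hc, hcF⟩ : ∃ c ∈ Set.uIcc (ψ x) (ψ y), c ∉ ψ '' F :=
    (Set.Icc_infinite (inf_lt_sup.2 hne)).exists_notMem_finite (hF.image ψ)
  let L : Set ℝ := Set.Icc T.u₀ T.uEnd ∩ ψ ⁻¹' {c}
  have hLc : IsCompact L := isCompact_Icc.of_isClosed_subset
    (hψ.preimage_isClosed_of_isClosed isClosed_Icc isClosed_singleton) Set.inter_subset_left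
  have hLne : L.Nonempty := by
    have := (isPreconnected_Icc.image ψ hψ).ordConnected.uIcc_subset
      (Set.mem_image_of_mem ψ hx) (Set.mem_image_of_mem ψ hy) hc
    obtain ⟨z, hz, rfl⟩ := this
    exact ⟨z, hz, rfl⟩
  have hLF : ∀ z ∈ L, z ∉ F := fun z hz hzF => hcF ⟨z, hzF, hz.2⟩
  have hFne : F.Nonempty := ⟨_, 0, Nat.zero_le _, rfl⟩
  obtain ⟨z₀, hz₀, hmin⟩ := hLc.exists_isMinOn hLne (Metric.continuous_infDist_pt F).continuousOn
  set δ := Metric.infDist z₀ F with hδdef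
  have hδ : 0 < δ := (hF.isClosed.notMem_iff_infDist_pos hFne).1 (hLF _ hz₀)
  have hδle : ∀ z ∈ L, ∀ k ≤ Fintype.card A, δ ≤ |z - T.topPt k| := fun z hz k hk =>
    (isMinOn_iff.1 hmin z hz).trans (Metric.infDist_le_dist_of_mem ⟨k, hk, rfl⟩)
  have hex : ∀ z : L, ∃ α, (z : ℝ) ∈ T.topInterval α := fun z =>
    T.exists_mem_topInterval z.2.1 fun k hk h => hLF z z.2 (h ▸ ⟨k, hk, rfl⟩)
  choose α hα using hex
  have hright (z : L) : (z : ℝ) + δ ≤ T.topRight (α z) := by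
    have h1 := hδle z z.2 _ (T.data.top (α z)).isLt
    have h2 := (hα z).2
    rw [abs_sub_comm] at h1
    change δ ≤ |T.topRight (α z) - z| at h1
    rw [abs_of_pos (sub_pos.2 h2)] at h1
    linarith
  have hnext (z : L) : (z : ℝ) + T.shift (α z) ∈ L := by
    refine ⟨?_, (hinv' (hα z)).trans z.2.2⟩
    rw [← T.map_eq ⟨z, T.mem_domain (hα z)⟩ (hα z)]
    exact Set.Ioo_subset_Icc_self (T.map_mem_Ioo _)
  let f : L → L := fun z => ⟨_, hnext z⟩
  obtain ⟨a, haL, hamax⟩ := hLc.exists_isGreatest hLne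
  let w : ℕ → L := fun n => f^[n] ⟨a, haL⟩
  have hw (n) : (w (n + 1) : ℝ) = w n + T.shift (α (w n)) := by
    simp only [w, Function.iterate_succ_apply']; rfl
  -- The gap of length δ to the right of the maximum of `L` is carried along its orbit. As `w n + δ`
  -- does not pass the right end of the interval of `w n`, a point of `L` in the next gap would pull
  -- back to one in the current gap. The orbit is therefore δ-separated, so it repeats a value.
  have hgap : ∀ n, ∀ z ∈ L, (w n : ℝ) < z → δ ≤ z - w n := by
    intro n
    induction n with
    | zero => exact fun z hz h => absurd (hamax hz) (not_le.2 h)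
    | succ n ih =>
      intro z hz hlt
      by_contra! hcon
      rw [hw] at hlt hcon
      have hz' : z - T.shift (α (w n)) ∈ T.topInterval (α (w n)) :=
        ⟨(hα (w n)).1.trans (by linarith), lt_of_lt_of_le (by linarith) (hright (w n))⟩
      have hzL : z - T.shift (α (w n)) ∈ L := by
        refine ⟨Set.Ioo_subset_Icc_self (T.topInterval_subset _ hz'), ?_⟩
        have := hinv' hz'
        rw [sub_add_cancel] at this
        exact this.symm.trans hz.2
      have := ih _ hzL (by linarith)
      linarith
  obtain ⟨m, n, hmn, heq⟩ := exists_eq_of_separated (x := fun n => (w n : ℝ)) hδ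
    (fun n => (w n).2.1) fun m n h => hgap m _ (w n).2 h
  refine T.hasConnection_of_periodic (x := fun k => (w (m + k) : ℝ))
    (a := fun k => α (w (m + k))) (fun k => hα _) (fun k => hw (m + k)) (p := n - m)
    (by omega) fun k => ?_
  have h1 : w m = w n := Subtype.ext heq
  have h2 (i j) : w (i + j) = f^[j] (w i) := by
    simp only [w, ← Function.iterate_add_apply, add_comm]
  have h3 : m + (k + (n - m)) = n + k := by omega
  change ((w (m + (k + (n - m))) : L) : ℝ) = w (m + k)
  rw [h3, h2, h2, h1]

/-! ### Derivatives of coboundaries and the dimension of Γ_T(r). -/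

lemma D_coboundary {ψ : ℝ → ℝ} (hψ : DifferentiableOn ℝ ψ (Set.Icc T.u₀ T.uEnd)) {χ : T.Fn}
    (hχ : ∀ x : T.domain, χ x = ψ (T.map x) - ψ x) (x : T.domain) :
    T.D χ x = derivWithin ψ (Set.Icc T.u₀ T.uEnd) (T.map x) -
      derivWithin ψ (Set.Icc T.u₀ T.uEnd) x := by
  have hd {z : ℝ} (hz : z ∈ Set.Ioo T.u₀ T.uEnd) :
      HasDerivAt ψ (derivWithin ψ (Set.Icc T.u₀ T.uEnd) z) z :=
    (hψ z (Set.Ioo_subset_Icc_self hz)).hasDerivWithinAt.hasDerivAt (Icc_mem_nhds hz.1 hz.2)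
  have hx := T.mem_letter x
  rw [T.D_eq_of_eq (f := fun z => ψ (z + T.shift (T.letter x)) - ψ z) (fun y hy => by
    rw [hχ, T.map_eq y hy]) x hx]
  exact (((hd (T.map_mem_Ioo x)).comp_add_const (x : ℝ) _).sub
    (hd (T.topInterval_subset _ hx))).deriv

lemma GamTPoly_one : T.GamTPoly 1 = T.GamT := by
  unfold GamTPoly GamT
  congr 1
  ext χ
  constructor
  · rintro ⟨-, h⟩ α
    obtain ⟨p, hp, hp'⟩ := h α
    refine ⟨p.coeff 0, fun x hx => ?_⟩
    rw [hp' x hx, eq_C_of_degree_le_zero (Order.lt_succ_iff.1 hp)]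
    simp
  · intro h
    refine T.mem_GamPoly_of fun α => ?_
    obtain ⟨c, hc⟩ := h α
    exact ⟨C c, degree_C_le.trans_lt (by simp), fun x hx => by rw [hc x hx, eval_C]⟩

lemma D_mem_GamPoly_pred {n : ℕ} {χ : T.Fn} (hχ : χ ∈ T.GamPoly (n + 1)) :
    T.D χ ∈ T.GamPoly n := by
  refine T.mem_GamPoly_of fun α => ?_
  obtain ⟨p, hp, hp'⟩ := hχ.2 α
  refine ⟨derivative p, ?_, T.D_eq_eval hp'⟩
  rcases eq_or_ne p 0 with rfl | h0
  · simp
  · exact (degree_derivative_lt h0).trans_le (Order.lt_succ_iff.1 hp)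

/-- Derivation, from `Γ_T(n + 2)` to `Γ_T(n + 1)`. -/
def DGamT (n : ℕ) : T.GamTPoly (n + 2) →ₗ[ℝ] T.GamTPoly (n + 1) where
  toFun χ := ⟨T.D χ, T.D_mem_GamPoly_pred χ.2.1, by
    obtain ⟨ψ, hψ, hχ⟩ := χ.2.2
    have h : ContDiffOn ℝ ((n : WithTop ℕ∞) + 1) ψ (Set.Icc T.u₀ T.uEnd) := by
      simpa using hψ
    exact ⟨_, ((contDiffOn_succ_iff_derivWithin (uniqueDiffOn_Icc T.u₀_lt_uEnd)).1 h).2.2,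
      T.D_coboundary (h.differentiableOn (by simp)) hχ⟩⟩
  map_add' χ ξ := Subtype.ext (T.D_add χ.2.1 ξ.2.1)
  map_smul' c χ := Subtype.ext (T.D_smul c χ.2.1)

lemma exists_derivative_eq {p : ℝ[X]} {n : ℕ} (hp : p.degree < ((n + 1 : ℕ) : WithBot ℕ)) :
    ∃ q : ℝ[X], q.degree < ((n + 2 : ℕ) : WithBot ℕ) ∧ derivative q = p := by
  refine ⟨∑ i ∈ Finset.range (n + 1), C (p.coeff i / (i + 1)) * X ^ (i + 1), ?_, ?_⟩
  · rw [← mem_degreeLT]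
    refine Submodule.sum_mem _ fun i hi => mem_degreeLT.2 ?_
    refine (degree_C_mul_X_pow_le _ _).trans_lt ?_
    have := Finset.mem_range.1 hi
    exact_mod_cast (show i + 1 < n + 2 by omega)
  · have hp' : p.natDegree < n + 1 := by
      rcases eq_or_ne p 0 with rfl | h0
      · simp
      · exact (natDegree_lt_iff_degree_lt h0).2 hp
    conv_rhs => rw [p.as_sum_range_C_mul_X_pow' hp']
    rw [derivative_sum]
    refine Finset.sum_congr rfl fun i _ => ?_
    rw [derivative_C_mul_X_pow, Nat.add_sub_cancel]
    congr 2
    push_cast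
    exact div_mul_cancel₀ _ (by positivity)

/-- A function whose derivative is a polynomial on an interval is itself a polynomial there. -/
lemma exists_eval_of_hasDerivAt {f : ℝ → ℝ} {p : ℝ[X]} {a b : ℝ}
    (h : ∀ x ∈ Set.Ioo a b, HasDerivAt f (p.eval x) x) {n : ℕ}
    (hp : p.degree < ((n + 1 : ℕ) : WithBot ℕ)) :
    ∃ q : ℝ[X], q.degree < ((n + 2 : ℕ) : WithBot ℕ) ∧ ∀ x ∈ Set.Ioo a b, f x = q.eval x := by
  obtain ⟨q, hq, rfl⟩ := exists_derivative_eq hp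
  have hd {x} (hx : x ∈ Set.Ioo a b) : HasDerivAt (fun x => f x - q.eval x) 0 x := by
    have := (h x hx).sub (q.hasDerivAt x)
    rw [sub_self] at this
    exact this
  obtain ⟨c, hc⟩ := isOpen_Ioo.exists_is_const_of_deriv_eq_zero isPreconnected_Ioo
    (fun x hx => (hd hx).differentiableAt.differentiableWithinAt) fun x hx => (hd hx).deriv
  refine ⟨q + C c, (degree_add_le _ _).trans_lt (max_lt hq (degree_C_le.trans_lt ?_)),
    fun x hx => ?_⟩
  · exact_mod_cast Nat.succ_pos _
  · rw [eval_add, eval_C, ← hc x hx]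
    ring

/-- A primitive `Ψ` of the transfer function works: T is a local translation, so `Ψ ∘ T - Ψ` has
derivative `χ`, and is therefore piecewise polynomial of one degree more. -/
lemma DGamT_surjective (n : ℕ) : Function.Surjective (T.DGamT n) := by
  rintro ⟨χ, hχ, ψ, hψ, hψχ⟩
  have hlt := T.u₀_lt_uEnd
  -- Extending continuously to the whole line makes the primitive differentiable at the endpoints
  -- too.
  let ψ' : ℝ → ℝ := Set.IccExtend hlt.le ((Set.Icc T.u₀ T.uEnd).domRestrict ψ)
  have hψ'c : Continuous ψ' :=
    (continuousOn_iff_continuous_domRestrict.1 hψ.continuousOn).Icc_extend'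
  have hψ' : ∀ x ∈ Set.Icc T.u₀ T.uEnd, ψ' x = ψ x := fun x hx =>
    Set.IccExtend_of_mem hlt.le _ hx
  let Ψ : ℝ → ℝ := fun x => ∫ y in T.u₀..x, ψ' y
  have hΨ : ∀ x, HasDerivAt Ψ (ψ' x) x := fun x => hψ'c.integral_hasStrictDerivAt _ _ |>.hasDerivAt
  have hΨs : ContDiffOn ℝ ((n : WithTop ℕ∞) + 1) Ψ (Set.Icc T.u₀ T.uEnd) := by
    rw [contDiffOn_succ_iff_derivWithin (uniqueDiffOn_Icc hlt)]
    refine ⟨fun x _ => (hΨ x).differentiableAt.differentiableWithinAt, by simp, ?_⟩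
    have h1 : ContDiffOn ℝ n ψ (Set.Icc T.u₀ T.uEnd) := by simpa using hψ
    refine h1.congr fun x hx => ?_
    rw [(hΨ x).hasDerivWithinAt.derivWithin (uniqueDiffOn_Icc hlt x hx), hψ' x hx]
  let Χ : T.Fn := fun x => Ψ (T.map x) - Ψ x
  have hder {α : A} {x : ℝ} (hx : x ∈ T.topInterval α) :
      HasDerivAt (fun z => Ψ (z + T.shift α) - Ψ z) (χ ⟨x, T.mem_domain hx⟩) x := by
    have h1 := T.map_mem_Ioo ⟨x, T.mem_domain hx⟩
    rw [hψχ, ← hψ' _ (Set.Ioo_subset_Icc_self h1),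
      ← hψ' _ (Set.Ioo_subset_Icc_self (T.topInterval_subset _ hx)),
      T.map_eq ⟨x, T.mem_domain hx⟩ hx]
    exact ((hΨ _).comp_add_const x _).sub (hΨ x)
  have hΧ : ∀ α, ∀ x : T.domain, (x : ℝ) ∈ T.topInterval α →
      Χ x = Ψ (x + T.shift α) - Ψ x := fun α x hx => by simp only [Χ, T.map_eq x hx]
  have hmem : Χ ∈ T.GamPoly (n + 2) := by
    refine T.mem_GamPoly_of fun α => ?_
    obtain ⟨p, hp, hp'⟩ := hχ.2 α
    obtain ⟨q, hq, hq'⟩ := exists_eval_of_hasDerivAt (a := T.topLeft α) (b := T.topRight α)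
      (f := fun z => Ψ (z + T.shift α) - Ψ z) (p := p) (fun x hx => by
        have hx' : x ∈ T.topInterval α := hx
        rw [← hp' ⟨x, T.mem_domain hx'⟩ hx']
        exact hder hx') hp
    exact ⟨q, hq, fun x hx => (hΧ α x hx).trans (hq' x hx)⟩
  refine ⟨⟨Χ, hmem, Ψ, by simpa using hΨs, fun x => rfl⟩, Subtype.ext (funext fun x => ?_)⟩
  have hx := T.mem_letter x
  exact (T.D_eq_of_eq (hΧ _) x hx).trans (hder hx).deriv

/-- The translation vector of the map, as a function on the domain. -/
def shiftFn : T.Fn := fun x => T.map x - x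

lemma shiftFn_mem (n : ℕ) : T.shiftFn ∈ T.GamTPoly (n + 2) := by
  refine ⟨T.mem_GamPoly_of fun α => ⟨C (T.shift α), degree_C_le.trans_lt ?_, fun x hx => ?_⟩,
    id, contDiffOn_id, fun x => rfl⟩
  · exact_mod_cast Nat.succ_pos _
  · rw [shiftFn, T.map_eq x hx, eval_C]; ring

lemma D_shiftFn : T.D T.shiftFn = 0 := by
  funext x
  rw [T.D_eq_of_eq (f := fun _ => T.shift (T.letter x)) (fun y hy => by
    rw [shiftFn, T.map_eq y hy]; ring) x (T.mem_letter x)]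
  simp

/-- By irreducibility the first top interval is moved strictly to the right. -/
lemma shiftFn_ne_zero : T.shiftFn ≠ 0 := by
  intro h
  set α := T.data.top.symm ⟨0, T.card_pos⟩ with hα
  have hα' : (T.data.top α : ℕ) = 0 := by simp [hα]
  obtain ⟨x, hx⟩ := Set.nonempty_Ioo.2 (T.topLeft_lt_topRight α)
  have hx' : x ∈ T.topInterval α := hx
  have h1 := congrFun h ⟨x, T.mem_domain hx'⟩
  rw [shiftFn, T.map_eq ⟨x, T.mem_domain hx'⟩ hx', shift, hα', topPt_zero] at h1
  have h2 := T.botPt_lt (Nat.pos_of_ne_zero (T.bot_ne_zero hα')) (Fin.isLt _).le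
  rw [botPt_zero] at h2
  simp only [Pi.zero_apply] at h1
  linarith

/-- This is where the absence of connections enters: ψ' is continuous and invariant, hence a
constant c, so ψ - c·id is constant and χ is c times the translation function. -/
lemma eq_smul_shiftFn (hT : ¬ T.HasConnection) {n : ℕ} {χ : T.Fn} (hχ : χ ∈ T.GamTPoly (n + 2))
    (hD : T.D χ = 0) : ∃ c : ℝ, c • T.shiftFn = χ := by
  obtain ⟨-, ψ, hψ, hψχ⟩ := hχ
  have hlt := T.u₀_lt_uEnd
  have h : ContDiffOn ℝ ((n : WithTop ℕ∞) + 1) ψ (Set.Icc T.u₀ T.uEnd) := by simpa using hψ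
  have hdiff : DifferentiableOn ℝ ψ (Set.Icc T.u₀ T.uEnd) := h.differentiableOn (by simp)
  have hcont := ((contDiffOn_succ_iff_derivWithin (uniqueDiffOn_Icc hlt)).1 h).2.2.continuousOn
  have hu : T.u₀ ∈ Set.Icc T.u₀ T.uEnd := ⟨le_rfl, hlt.le⟩
  set c := derivWithin ψ (Set.Icc T.u₀ T.uEnd) T.u₀ with hc
  have hconst : ∀ x ∈ Set.Icc T.u₀ T.uEnd, derivWithin ψ (Set.Icc T.u₀ T.uEnd) x = c :=
    fun x hx => T.eq_of_continuousOn_of_invariant hT hcont (fun x => by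
      have := T.D_coboundary hdiff hψχ x
      rw [hD] at this
      exact sub_eq_zero.1 this.symm) hx hu
  have hlin := constant_of_derivWithin_zero (f := fun x => ψ x - c * x)
    (hdiff.sub (differentiableOn_id.const_mul c)) fun x hx => by
      have hx' := Set.Ico_subset_Icc_self hx
      have h1 := (hdiff x hx').hasDerivWithinAt.sub
        ((hasDerivWithinAt_id x (Set.Icc T.u₀ T.uEnd)).const_mul c)
      rw [hconst x hx', mul_one, sub_self] at h1
      exact h1.derivWithin (uniqueDiffOn_Icc hlt x hx')
  refine ⟨c, funext fun x => ?_⟩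
  have h1 := hlin _ (Set.Ioo_subset_Icc_self (T.map_mem_Ioo x))
  have h2 := hlin _ (Set.Ioo_subset_Icc_self (T.topInterval_subset _ (T.mem_letter x)))
  simp only [Pi.smul_apply, smul_eq_mul, shiftFn, hψχ x]
  linarith

instance finite_GamTPoly (r : ℕ) : Module.Finite ℝ (T.GamTPoly r) :=
  Submodule.finiteDimensional_of_le (inf_le_left : T.GamTPoly r ≤ T.GamPoly r)

lemma finrank_GamTPoly_succ (hT : ¬ T.HasConnection) (n : ℕ) :
    Module.finrank ℝ (T.GamTPoly (n + 2)) = Module.finrank ℝ (T.GamTPoly (n + 1)) + 1 := by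
  have h1 := LinearMap.finrank_range_add_finrank_ker (T.DGamT n)
  rw [LinearMap.range_eq_top.2 (T.DGamT_surjective n), finrank_top] at h1
  rw [← h1]
  congr 1
  let v : LinearMap.ker (T.DGamT n) :=
    ⟨⟨T.shiftFn, T.shiftFn_mem n⟩, LinearMap.mem_ker.2 (Subtype.ext T.D_shiftFn)⟩
  have hv : v ≠ 0 := fun h => T.shiftFn_ne_zero
    (congrArg (fun w : LinearMap.ker (T.DGamT n) => ((w : T.GamTPoly (n + 2)) : T.Fn)) h)
  refine (finrank_eq_one_iff_of_nonzero' v hv).2 ?_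
  rintro ⟨⟨χ, hχ⟩, hD⟩
  obtain ⟨c, hc⟩ := T.eq_smul_shiftFn hT hχ (congrArg Subtype.val (LinearMap.mem_ker.1 hD))
  exact ⟨c, Subtype.ext (Subtype.ext hc)⟩

lemma finrank_GamTPoly (hT : ¬ T.HasConnection) (n : ℕ) :
    Module.finrank ℝ (T.GamTPoly (n + 1)) = Module.finrank ℝ T.GamT + n := by
  induction n with
  | zero => rw [zero_add, GamTPoly_one, add_zero]
  | succ n ih => rw [finrank_GamTPoly_succ T hT, ih, add_assoc]

end StandardIEM

end

theorem proposition3p12 {A : Type*} [Fintype A] (T : StandardIEM A) (hT : ¬ T.HasConnection)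
    (r : ℕ) (hr : 1 ≤ r) :
    Module.finrank ℝ (T.GamPoly r) = r * Fintype.card A ∧
    (Module.finrank ℝ (T.GamBdry r) : ℤ) = (2 * T.data.genus - 1) * r + 1 ∧
    Module.finrank ℝ (T.GamTPoly r) = Module.finrank ℝ T.GamT + (r - 1) := by
  refine ⟨T.finrank_GamPoly r, T.finrank_GamBdry hr, ?_⟩
  obtain ⟨n, rfl⟩ := Nat.exists_eq_add_of_le' hr
  rw [T.finrank_GamTPoly hT, Nat.add_sub_cancel]
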